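/- \textbf{Setting.} Let $(E;\oplus,0,1)$ be an effect algebra: $\oplus$ is a partial operation, commutative and associative where defined, every $a\in E$ has a unique $a'\in E$ with $a\oplus a'=1$, and $a=0$ whenever $a\oplus 1$ is defined. Put $a\le b$ iff $a\oplus c=b$ for some (then unique) $c=:b\ominus a$. An additive map $J:E\to E$ is a compression if $J(a)=a$ whenever $a\le J(1)$, and $J(a)=0\iff a\le J(1)'$. Elements $a,b$ are Mackey compatible, $a\leftrightarrow b$, if $a=a_1\oplus c$, $b=b_1\oplus c$ with $a_1\oplus b_1\oplus c$ defined. Let $(J_p)_{p\in P}$ be a compression base on $E$: $P$ is a sub-effect algebra, each $J_p$ is a compression with $J_p(1)=p$, and if $p,q\in P$ and $p\leftrightarrow q$ then $J_pJ_q=J_r$ for some $r\in P$. Put $C(p)=\{a: a=J_p(a)\oplus J_{p'}(a)\}$ for $p\in P$, $C(B)=\bigcap_{p\in B}C(p)$ for $B\subseteq P$, $PC(A)=\{p\in P: A\subseteq C(p)\}$ and $P(A)=PC(PC(A)\cup A)$ for $A\subseteq E$; write $P(a)=P(\{a\})$, $P(e,f)=P(\{e,f\})$. A block of $P$ is a maximal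 set $B\subseteq P$ of pairwise Mackey compatible elements; then $C(B)$ is called a C-block of $E$. Assume that $E$ is spectral, that is: (1) for each $a\in E$ there is a Boolean subalgebra $B(a)\subseteq P$ such that for all $p\in P$: $a\in C(p)\iff B(a)\subseteq C(p)$; (2) for all $e,f\in E$ such that $p\leftrightarrow q$ for all $p\in P(e)$, $q\in P(f)$, the set $P_\le(e,f)=\{p\in P(e,f): J_p(e)\le J_p(f),\ J_{p'}(f)\le J_{p'}(e)\}$ is nonempty; (3) each $a\in E$ has a projection cover $a^\circ\in P$: for all $q\in P$, $a\le q\iff a^\circ\le q$. For $e,f$ as in (2), $(f-e)_+:=J_p(f)\ominus J_p(e)$, where $p\in P_\le(e,f)$ is arbitrary (the value does not depend on $p$). \textbf{Binary spectral resolution.} For $a\in E$ put $c_\varepsilon=a$, $u_\varepsilon=a^\circ$ for the empty word $\varepsilon$, and for each binary word $w$ \[ u_{w0}=((c_w-c_w')_+{}^{\circ})'\wedge u_w,\quad u_{w1}=u_w\wedge u_{w0}',\quad c_{w0}=u_{w0}\ominus[(c_w'-c_w)_+\wedge u_w],\quad c_{w1}=(c_w-c_w')_+\wedge u_w . \] For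 $w=w_1\dots w_n$ let $\lambda(w)=\sum_{j=1}^n w_j2^{-j}$; every dyadic rational in $(0,1)$ is $\lambda(w1)$ for a unique $w$. Put $p_0=(a^\circ)'$, $p_1=1$, and \[ p_{\lambda(w1)}=(a^\circ)'\oplus\bigoplus_{v} u_v , \] the sum over all binary words $v$ of length $n+1$ that are lexicographically at most $w0$. \textbf{Rational spectral resolution.} Let $C=C(B)$ be a C-block containing $a$; it is a sub-effect algebra of $E$. Let $G$ be its universal group (the abelian group generated by the elements of $C$ with the relations $[b\oplus c]=[b]+[c]$), ordered by the cone generated by the image of $C$, and let $u$ be the image of $1$. For $p\in B$ the restriction of $J_p$ to $C$ extends to a group endomorphism $\tilde U_p$ of $G$. Write $g_+=g\vee 0$, and let $g^*\in B$ be the element such that for all $p\in B$: $p\le g^*\iff g=\tilde U_p(g)+\tilde U_{p'}(g)$ and $\tilde U_p(g)=0$. For $\lambda=m/n$ with $m\in\mathbb Z$, $n\in\mathbb N$, $n>0$, put $p^C_\lambda=((na-mu)_+)^*$. \textbf{Theorem.} Let $E$ be spectral and $a\in E$. For every dyadic rational $\lambda\in[0,1]$ the projection $p_\lambda\in P$ is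 well defined, and for every C-block $C$ of $E$ with $a\in C$ and every representation $\lambda=m/n$, the projection $p^C_\lambda$ is well defined and \[ p^C_\lambda=p_\lambda . \] In particular, $p^C_\lambda$ does not depend on the C-block $C$ containing $a$. -/

import Mathlib

universe u

/-- The unique element of `S`, if `S` has exactly one element; undefined (`none`) otherwise. -/
noncomputable def theUnique {α : Type*} (S : Set α) : Option α :=
  open Classical in if h : ∃! x, x ∈ S then some h.choose else none

/-! ### Effect algebras -/

/-- Effect algebras. The partial operation is `oplus`; `oplus a b = none` means that
`a ⊕ b` is not defined. `ortho a` is the orthosupplement `a'`. -/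
class EffectAlgebra (E : Type u) extends Zero E, One E where
  oplus : E → E → Option E
  ortho : E → E
  oplus_comm : ∀ a b : E, oplus a b = oplus b a
  oplus_assoc : ∀ a b c d e : E, oplus a b = some d → oplus d c = some e →
    ∃ f, oplus b c = some f ∧ oplus a f = some e
  oplus_ortho : ∀ a : E, oplus a (ortho a) = some 1
  eq_ortho : ∀ a b : E, oplus a b = some 1 → b = ortho a
  eq_zero_of_oplus_one : ∀ a b : E, oplus a 1 = some b → a = 0

namespace EffectAlgebra

section Basic

variable {E : Type u} [EffectAlgebra E]

/-- The order of an effect algebra: `a ≤ b` iff `a ⊕ c = b` for some `c`. -/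
def Le (a b : E) : Prop := ∃ c, oplus a c = some b

/-- The partial difference `b ⊖ a`: the unique `c` with `a ⊕ c = b`. -/
noncomputable def ominus (b a : E) : Option E := theUnique {c | oplus a c = some b}

/-- The (partially defined) infimum `a ∧ b` in `E`. -/
noncomputable def meet (a b : E) : Option E :=
  theUnique {m | Le m a ∧ Le m b ∧ ∀ x, Le x a → Le x b → Le x m}

/-- The (partially defined) orthosum of a finite list. -/
def osum : List E → Option E
  | [] => some 0
  | x :: xs => (osum xs).bind (oplus x)

/-- Mackey compatibility `a ↔ b`: `a = a₁ ⊕ c` and `b = b₁ ⊕ c`, where `a₁ ⊕ b₁ ⊕ c` exists. -/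
def Compat (a b : E) : Prop :=
  ∃ a₁ b₁ c s, oplus a₁ c = some a ∧ oplus b₁ c = some b ∧ oplus a₁ b = some s

/-- Additive maps. -/
def IsAdditive {F : Type*} [EffectAlgebra F] (J : E → F) : Prop :=
  ∀ a b c, oplus a b = some c → oplus (J a) (J b) = some (J c)

/-- Retractions. -/
def IsRetraction (J : E → E) : Prop :=
  IsAdditive J ∧ ∀ a, Le a (J 1) → J a = a

/-- Compressions. -/
def IsCompression (J : E → E) : Prop :=
  IsRetraction J ∧ ∀ a, J a = 0 ↔ Le a (ortho (J 1))

/-! Elementary facts. -/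

theorem ortho_ortho (a : E) : ortho (ortho a) = a :=
  (eq_ortho _ _ (by rw [oplus_comm, oplus_ortho])).symm

theorem ortho_one : ortho (1 : E) = 0 :=
  eq_zero_of_oplus_one _ 1 (by rw [oplus_comm, oplus_ortho])

theorem oplus_zero (a : E) : oplus a 0 = some a := by
  have h1 : oplus (1 : E) 0 = some 1 := by rw [← ortho_one, oplus_ortho]
  have h2 : oplus (ortho a) a = some 1 := by rw [oplus_comm, oplus_ortho]
  obtain ⟨f, hf, hf'⟩ := oplus_assoc _ _ _ _ _ h2 h1
  rw [hf, eq_ortho _ _ hf', ortho_ortho]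

theorem zero_oplus (a : E) : oplus 0 a = some a := by rw [oplus_comm, oplus_zero]

theorem oplus_assoc' (a b c f e : E) (h : oplus b c = some f) (h' : oplus a f = some e) :
    ∃ d, oplus a b = some d ∧ oplus d c = some e := by
  rw [oplus_comm] at h h'
  obtain ⟨d, h1, h2⟩ := oplus_assoc _ _ _ _ _ h h'
  exact ⟨d, by rw [oplus_comm, h1], by rw [oplus_comm, h2]⟩

/-- The exchange law `(a ⊕ b) ⊕ (c ⊕ d) = (a ⊕ c) ⊕ (b ⊕ d)`. -/
theorem oplus_exchange {a b c d x y s : E} (h1 : oplus a b = some x) (h2 : oplus c d = some y)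
    (h3 : oplus x y = some s) :
    ∃ v w, oplus a c = some v ∧ oplus b d = some w ∧ oplus v w = some s := by
  obtain ⟨f, hf, hf'⟩ := oplus_assoc _ _ _ _ _ h1 h3
  obtain ⟨g, hg, hg'⟩ := oplus_assoc' _ _ _ _ _ h2 hf
  rw [oplus_comm] at hg
  obtain ⟨k, hk, hk'⟩ := oplus_assoc _ _ _ _ _ hg hg'
  obtain ⟨l, hl, hl'⟩ := oplus_assoc' _ _ _ _ _ hk' hf'
  exact ⟨l, k, hl, hk, hl'⟩

theorem le_ortho_of_oplus {a b c : E} (h : oplus a b = some c) : Le a (ortho b) := by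
  rw [oplus_comm] at h
  obtain ⟨f, hf, hf'⟩ := oplus_assoc _ _ _ _ _ h (oplus_ortho c)
  exact ⟨ortho c, by rw [hf, eq_ortho _ _ hf']⟩

theorem compat_symm {a b : E} : Compat a b → Compat b a := by
  rintro ⟨a₁, b₁, c, s, h1, h2, h3⟩
  obtain ⟨x, hx, hx'⟩ := oplus_assoc' _ _ _ _ _ (show oplus c b₁ = some b by
    rw [oplus_comm, h2]) h3
  rw [h1, Option.some.injEq] at hx
  exact ⟨b₁, a₁, c, s, h2, h1, by rw [oplus_comm, hx, hx']⟩

theorem compat_ortho {a b : E} : Compat a b → Compat a (ortho b) := by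
  rintro ⟨a₁, b₁, c, s, h1, h2, h3⟩
  have h4 : oplus b a₁ = some s := by rw [oplus_comm, h3]
  obtain ⟨f, hf, hf'⟩ := oplus_assoc _ _ _ _ _ h4 (oplus_ortho s)
  have hb : f = ortho b := eq_ortho _ _ hf'
  have h5 : oplus f b = some 1 := by rw [oplus_comm, hf']
  have h6 : oplus c b₁ = some b := by rw [oplus_comm, h2]
  obtain ⟨g, hg, -⟩ := oplus_assoc' _ _ _ _ _ h6 h5
  exact ⟨c, ortho s, a₁, g, by rw [oplus_comm, h1], by rw [oplus_comm, hf, hb],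
    by rw [oplus_comm, ← hb, hg]⟩

end Basic

end EffectAlgebra

open EffectAlgebra in
/-- Sub-effect algebras. -/
structure SubEffectAlgebra (E : Type u) [EffectAlgebra E] where
  carrier : Set E
  one_mem : 1 ∈ carrier
  ortho_mem : ∀ a ∈ carrier, ortho a ∈ carrier
  oplus_mem : ∀ a ∈ carrier, ∀ b ∈ carrier, ∀ c, oplus a b = some c → c ∈ carrier

namespace EffectAlgebra

section Sub

variable {E : Type u} [EffectAlgebra E] (F : SubEffectAlgebra E)

/-- The operation of `E` restricted to a sub-effect algebra. -/
def subOplus (a b : F.carrier) : Option F.carrier :=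
  (oplus (a : E) (b : E)).pmap Subtype.mk (fun c hc => F.oplus_mem a a.2 b b.2 c hc)

theorem subOplus_eq (a b c : F.carrier) :
    subOplus F a b = some c ↔ oplus (a : E) (b : E) = some (c : E) := by
  unfold subOplus
  rw [Option.pmap_eq_some_iff]
  constructor
  · rintro ⟨x, -, hx, rfl⟩
    exact hx
  · intro h
    exact ⟨c, c.2, h, rfl⟩

/-- A sub-effect algebra is an effect algebra with the restricted operation. -/
instance subInstance : EffectAlgebra F.carrier where
  zero := ⟨0, ortho_one (E := E) ▸ F.ortho_mem 1 F.one_mem⟩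
  one := ⟨1, F.one_mem⟩
  oplus := subOplus F
  ortho a := ⟨ortho (a : E), F.ortho_mem a a.2⟩
  oplus_comm a b := by
    ext c
    rw [subOplus_eq, subOplus_eq, oplus_comm]
  oplus_assoc a b c d e h h' := by
    rw [subOplus_eq] at h h'
    obtain ⟨f, hf, hf'⟩ := oplus_assoc _ _ _ _ _ h h'
    exact ⟨⟨f, F.oplus_mem b b.2 c c.2 f hf⟩, (subOplus_eq F _ _ _).2 hf,
      (subOplus_eq F _ _ _).2 hf'⟩
  oplus_ortho a := (subOplus_eq F _ _ _).2 (oplus_ortho (a : E))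
  eq_ortho a b h := Subtype.ext (eq_ortho _ _ ((subOplus_eq F _ _ _).1 h))
  eq_zero_of_oplus_one a b h :=
    Subtype.ext (eq_zero_of_oplus_one _ _ ((subOplus_eq F _ _ _).1 h))

end Sub

end EffectAlgebra

/-! ### Compression bases and spectrality -/

open EffectAlgebra in
/-- A compression base `(J_p)_{p ∈ P}` on `E`. The values of `J` outside `P` play no role. -/
structure CompressionBase (E : Type u) [EffectAlgebra E] where
  P : SubEffectAlgebra E
  J : E → E → E
  isCompression : ∀ p ∈ P.carrier, IsCompression (J p)
  focus : ∀ p ∈ P.carrier, J p 1 = p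
  comp : ∀ p ∈ P.carrier, ∀ q ∈ P.carrier, Compat p q →
    ∃ r ∈ P.carrier, ∀ x, J p (J q x) = J r x

namespace CompressionBase

open EffectAlgebra

variable {E : Type u} [EffectAlgebra E] (K : CompressionBase E)

/-- The commutant `C(p)`. -/
def C (p : E) : Set E := {a | oplus (K.J p a) (K.J (ortho p) a) = some a}

/-- `PC(A)`: the projections commuting with all elements of `A`. -/
def PC (A : Set E) : Set E := {p | p ∈ K.P.carrier ∧ ∀ a ∈ A, a ∈ K.C p}

/-- The bicommutant `P(A) = PC(PC(A) ∪ A)`. -/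
def bicomm (A : Set E) : Set E := K.PC (K.PC A ∪ A)

/-- `B` is a Boolean subalgebra of `P`: a sub-effect algebra contained in `P` that is a Boolean
algebra with respect to the inherited order and orthosupplementation. -/
def IsBooleanSubalgebra (B : SubEffectAlgebra E) : Prop :=
  B.carrier ⊆ K.P.carrier ∧ ∃ L : BooleanAlgebra B.carrier,
    (∀ x y : B.carrier, L.le x y ↔ Le (x : E) (y : E)) ∧
    ∀ x : B.carrier, ((L.compl x : B.carrier) : E) = ortho (x : E)

/-- The b-property of `E`. -/
def BProperty : Prop :=
  ∀ a : E, ∃ B : SubEffectAlgebra E, K.IsBooleanSubalgebra B ∧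
    ∀ p ∈ K.P.carrier, a ∈ K.C p ↔ B.carrier ⊆ K.C p

/-- Commuting elements: `eCf` iff `P(e) ↔ P(f)`. -/
def Commute (e f : E) : Prop := ∀ p ∈ K.bicomm {e}, ∀ q ∈ K.bicomm {f}, Compat p q

/-- The set `P_≤(e, f)`. -/
def PLe (e f : E) : Set E :=
  {p | p ∈ K.bicomm {e, f} ∧ Le (K.J p e) (K.J p f) ∧
    Le (K.J (ortho p) f) (K.J (ortho p) e)}

/-- The b-comparability property. -/
def BComparability : Prop :=
  K.BProperty ∧ ∀ e f : E, K.Commute e f → (K.PLe e f).Nonempty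

/-- `p` is a projection cover of `a`. -/
def IsCover (a p : E) : Prop :=
  p ∈ K.P.carrier ∧ ∀ q ∈ K.P.carrier, Le a q ↔ Le p q

/-- The projection cover property. -/
def CoverProperty : Prop := ∀ a : E, ∃ p, K.IsCover a p

/-- Spectrality of `E` with respect to the given compression base. -/
def Spectral : Prop := K.BComparability ∧ K.CoverProperty

/-! ### The binary spectral resolution

All operations below are partial; an expression is defined (is not `none`) only if all its parts
are. -/

/-- The projection cover `a°`. -/
noncomputable def cover (a : E) : Option E := theUnique {p | K.IsCover a p}

/-- The positive part `(b - a)_+`: the common value of `J_p(b) ⊖ J_p(a)` over `p ∈ P_≤(a, b)`. -/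
noncomputable def posPart (b a : E) : Option E :=
  theUnique {x | ∃ p ∈ K.PLe a b, ominus (K.J p b) (K.J p a) = some x}

/-- The splitting step, from `(c_w, u_w)` to `(c_{w0}, u_{w0})` (for `false`) or
`(c_{w1}, u_{w1})` (for `true`):
`u_{w0} = ((c_w - c_w')_+°)' ∧ u_w`, `u_{w1} = u_w ∧ u_{w0}'`,
`c_{w0} = u_{w0} ⊖ [(c_w' - c_w)_+ ∧ u_w]`, `c_{w1} = (c_w - c_w')_+ ∧ u_w`. -/
noncomputable def splitStep (s : E × E) (bit : Bool) : Option (E × E) := do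
  let pos ← K.posPart s.1 (ortho s.1)
  let neg ← K.posPart (ortho s.1) s.1
  let e ← K.cover pos
  let u0 ← meet (ortho e) s.2
  let u1 ← meet s.2 (ortho u0)
  let negU ← meet neg s.2
  let c0 ← ominus u0 negU
  let c1 ← meet pos s.2
  if bit then some (c1, u1) else some (c0, u0)

/-- The pair `(c_w, u_w)` for a binary word `w`, starting from `(a, a°)` for the empty word. -/
noncomputable def splitting (a : E) (w : List Bool) : Option (E × E) := do
  let e ← K.cover a
  w.foldlM K.splitStep (a, e)

end CompressionBase

/-- All binary words of length `n`. -/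
def binaryWords : ℕ → List (List Bool)
  | 0 => [[]]
  | n + 1 => (binaryWords n).flatMap fun w => [w ++ [false], w ++ [true]]

/-- The dyadic rational `λ(w) = ∑ w_j 2^{-j}`. -/
def dyadicValue (w : List Bool) : ℚ :=
  ∑ j : Fin w.length, (if w[j] then 1 else 0) / 2 ^ ((j : ℕ) + 1)

namespace CompressionBase

open EffectAlgebra

section Resolution

variable {E : Type u} [EffectAlgebra E] (K : CompressionBase E)

/-- `(a°)' ⊕ ⨁ u_v`, the sum over the words `v` of the same length as `w0` that are
lexicographically at most `w0`. -/
noncomputable def midProjection (a : E) (w : List Bool) : Option E := do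
  let e ← K.cover a
  let us ← ((binaryWords (w.length + 1)).filter (fun v => v ≤ w ++ [false])).mapM
    (fun v => (K.splitting a v).map Prod.snd)
  let s ← osum us
  oplus (ortho e) s

/-- The binary spectral resolution `(p_l)` of `a`, indexed by the dyadic rationals `l` in
`[0, 1]`: `p_0 = (a°)'`, `p_1 = 1`, and `p_l` is the projection above if `l = λ(w1)`. -/
noncomputable def binaryResolution (a : E) (l : ℚ) : Option E :=
  theUnique {x | (l = 0 ∧ (K.cover a).map ortho = some x) ∨ (l = 1 ∧ x = 1) ∨
    ∃ w : List Bool, l = dyadicValue (w ++ [true]) ∧ K.midProjection a w = some x}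

end Resolution

end CompressionBase

/-! ### The universal group of an effect algebra -/

namespace EffectAlgebra

/-- The defining relations `[c] = [a] + [b]`, for `a ⊕ b = c`. -/
def universalRelations (A : Type u) [EffectAlgebra A] : AddSubgroup (FreeAbelianGroup A) :=
  AddSubgroup.closure {x | ∃ a b c : A, oplus a b = some c ∧
    x = FreeAbelianGroup.of c - (FreeAbelianGroup.of a + FreeAbelianGroup.of b)}

/-- The universal group of an effect algebra. -/
abbrev UniversalGroup (A : Type u) [EffectAlgebra A] : Type u :=
  FreeAbelianGroup A ⧸ universalRelations A

namespace UniversalGroup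

variable {A : Type u} [EffectAlgebra A]

/-- The canonical map into the universal group. -/
def of (a : A) : UniversalGroup A := QuotientAddGroup.mk (FreeAbelianGroup.of a)

/-- The positive cone, generated by the image of the effect algebra. -/
def cone (A : Type u) [EffectAlgebra A] : AddSubmonoid (UniversalGroup A) :=
  AddSubmonoid.closure (Set.range of)

/-- The order of the universal group. -/
def LeG (g h : UniversalGroup A) : Prop := h - g ∈ cone A

/-- The positive part `g_+ = g ∨ 0`. -/
noncomputable def pos (g : UniversalGroup A) : Option (UniversalGroup A) :=
  theUnique {h | LeG g h ∧ LeG 0 h ∧ ∀ k, LeG g k → LeG 0 k → LeG h k}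

/-- The group homomorphism induced by an additive map of effect algebras. -/
def map {A' : Type u} [EffectAlgebra A'] (J : A → A') (hJ : IsAdditive J) :
    UniversalGroup A →+ UniversalGroup A' :=
  QuotientAddGroup.map _ _ (FreeAbelianGroup.map J) (by
    unfold universalRelations
    rw [AddSubgroup.closure_le]
    rintro x ⟨a, b, c, h, rfl⟩
    refine AddSubgroup.subset_closure ⟨J a, J b, J c, hJ a b c h, ?_⟩
    simp)

theorem map_of {A' : Type u} [EffectAlgebra A'] (J : A → A') (hJ : IsAdditive J) (a : A) :
    map J hJ (of a) = of (J a) := by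
  simp [map, of]

end UniversalGroup

end EffectAlgebra

/-! ### C-blocks and the rational spectral resolution -/

namespace CompressionBase

open EffectAlgebra

variable {E : Type u} [EffectAlgebra E] (K : CompressionBase E)

/-- Blocks of `P`: maximal sets of pairwise Mackey compatible projections. -/
structure Block where
  carrier : Set E
  subset : carrier ⊆ K.P.carrier
  compat : ∀ p ∈ carrier, ∀ q ∈ carrier, Compat p q
  maximal : ∀ p ∈ K.P.carrier, (∀ q ∈ carrier, Compat p q) → p ∈ carrier

section Lemmas

variable {K}

theorem additive {p : E} (hp : p ∈ K.P.carrier) : IsAdditive (K.J p) :=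
  (K.isCompression p hp).1.1

theorem J_eq_self {p : E} (hp : p ∈ K.P.carrier) {a : E} (h : Le a p) : K.J p a = a :=
  (K.isCompression p hp).1.2 a (by rw [K.focus p hp]; exact h)

theorem J_eq_zero {p : E} (hp : p ∈ K.P.carrier) {a : E} (h : Le a (ortho p)) :
    K.J p a = 0 :=
  ((K.isCompression p hp).2 a).2 (by rw [K.focus p hp]; exact h)

theorem le_of_oplus {a b c : E} (h : oplus a b = some c) : Le b c :=
  ⟨a, by rw [oplus_comm, h]⟩

/-- `J_p(q) = d` if `p = p₁ ⊕ d`, `q = q₁ ⊕ d` and `q₁ ≤ p'`. -/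
theorem J_proj {p q p₁ q₁ d s : E} (hp : p ∈ K.P.carrier) (h1 : oplus p₁ d = some p)
    (h2 : oplus q₁ d = some q) (h3 : oplus q₁ p = some s) : K.J p q = d := by
  have h := additive hp _ _ _ h2
  rw [J_eq_zero hp (le_ortho_of_oplus h3), J_eq_self hp (le_of_oplus h1), zero_oplus] at h
  exact (Option.some.inj h).symm

theorem J_comm {p q : E} (hp : p ∈ K.P.carrier) (hq : q ∈ K.P.carrier) (h : Compat p q)
    (x : E) : K.J p (K.J q x) = K.J q (K.J p x) := by
  have h' := compat_symm h
  obtain ⟨r, hr, hr'⟩ := K.comp p hp q hq h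
  obtain ⟨t, ht, ht'⟩ := K.comp q hq p hp h'
  obtain ⟨p₁, q₁, d, s, h1, h2, h3⟩ := h
  have h4 : ∃ s', oplus q₁ p = some s' := by
    obtain ⟨y, hy, hy'⟩ := oplus_assoc' _ _ _ _ _ (show oplus d q₁ = some q by
      rw [oplus_comm, h2]) h3
    rw [h1, Option.some.injEq] at hy
    exact ⟨s, by rw [oplus_comm, hy, hy']⟩
  obtain ⟨s', h4⟩ := h4
  have e1 : r = d := by
    rw [← K.focus r hr, ← hr' 1, K.focus q hq, J_proj hp h1 h2 h4]
  have e2 : t = d := by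
    rw [← K.focus t ht, ← ht' 1, K.focus p hp, J_proj hq h2 h1 h3]
  rw [hr', ht', e1, e2]

theorem mem_C_of_compat {p q : E} (hp : p ∈ K.P.carrier) (h : Compat p q) : q ∈ K.C p := by
  have hp' := K.P.ortho_mem p hp
  obtain ⟨q₁, p₁, d, s, h2, h1, h3⟩ := compat_symm h
  have e1 : K.J p q = d := J_proj hp h1 h2 h3
  have h := additive hp' _ _ _ h2
  rw [J_eq_self hp' (le_ortho_of_oplus h3), J_eq_zero hp' (by
    rw [ortho_ortho]; exact le_of_oplus h1), oplus_zero] at h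
  unfold C
  rw [Set.mem_ofPred_eq, e1, ← Option.some.inj h, oplus_comm, h2]

theorem one_mem_C {p : E} (hp : p ∈ K.P.carrier) : (1 : E) ∈ K.C p := by
  unfold C
  rw [Set.mem_ofPred_eq, K.focus p hp, K.focus _ (K.P.ortho_mem p hp), oplus_ortho]

theorem oplus_mem_C {p : E} (hp : p ∈ K.P.carrier) {a b c : E} (ha : a ∈ K.C p)
    (hb : b ∈ K.C p) (h : oplus a b = some c) : c ∈ K.C p := by
  obtain ⟨v, w, hv, hw, hs⟩ := oplus_exchange ha hb h
  rw [additive hp _ _ _ h, Option.some.injEq] at hv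
  rw [additive (K.P.ortho_mem p hp) _ _ _ h, Option.some.injEq] at hw
  unfold C
  rw [Set.mem_ofPred_eq, hv, hw, hs]

theorem ortho_mem_C {p : E} (hp : p ∈ K.P.carrier) {a : E} (ha : a ∈ K.C p) :
    ortho a ∈ K.C p := by
  have hp' := K.P.ortho_mem p hp
  have h1 := additive hp _ _ _ (oplus_ortho a)
  have h2 := additive hp' _ _ _ (oplus_ortho a)
  obtain ⟨v, w, hv, hw, hs⟩ := oplus_exchange h1 h2 (one_mem_C hp)
  have e : v = a := Option.some.inj (hv.symm.trans ha)
  rw [e] at hs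
  unfold C
  rw [Set.mem_ofPred_eq, hw, eq_ortho _ _ hs]

theorem J_mem_C {p q : E} (hp : p ∈ K.P.carrier) (hq : q ∈ K.P.carrier) (h : Compat p q)
    {a : E} (ha : a ∈ K.C q) : K.J p a ∈ K.C q := by
  have h1 := additive hp _ _ _ ha
  rw [J_comm hp hq h, J_comm hp (K.P.ortho_mem q hq) (compat_ortho h)] at h1
  exact h1

end Lemmas

namespace Block

variable {K} (B : K.Block)

theorem ortho_mem {p : E} (hp : p ∈ B.carrier) : ortho p ∈ B.carrier :=
  B.maximal _ (K.P.ortho_mem p (B.subset hp)) fun q hq =>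
    compat_symm (compat_ortho (B.compat q hq p hp))

/-- The C-block `C(B)`, as a sub-effect algebra of `E`. -/
def cblock : SubEffectAlgebra E where
  carrier := {a | ∀ p ∈ B.carrier, a ∈ K.C p}
  one_mem p hp := one_mem_C (B.subset hp)
  ortho_mem a ha p hp := ortho_mem_C (B.subset hp) (ha p hp)
  oplus_mem a ha b hb c h p hp := oplus_mem_C (B.subset hp) (ha p hp) (hb p hp) h

/-- The inclusion of `B` into `C(B)`. -/
def incl (p : B.carrier) : B.cblock.carrier :=
  ⟨p, fun q hq => mem_C_of_compat (B.subset hq) (B.compat q hq p p.2)⟩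

/-- The restriction of `J_p` to `C(B)`, for `p ∈ B`. -/
def U (p : B.carrier) (a : B.cblock.carrier) : B.cblock.carrier :=
  ⟨K.J p a, fun q hq => J_mem_C (B.subset p.2) (B.subset hq) (B.compat p p.2 q hq) (a.2 q hq)⟩

theorem U_additive (p : B.carrier) : IsAdditive (B.U p) := fun a b c h =>
  (subOplus_eq B.cblock _ _ _).2
    (additive (B.subset p.2) _ _ _ ((subOplus_eq B.cblock _ _ _).1 h))

/-- The universal group `G` of the C-block. -/
abbrev G : Type u := UniversalGroup B.cblock.carrier

/-- The extension of `J_p` to a homomorphism of the universal group. -/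
def extU (p : B.carrier) : B.G →+ B.G := UniversalGroup.map (B.U p) (B.U_additive p)

/-- The orthosupplement in `B`. -/
def compl (p : B.carrier) : B.carrier := ⟨ortho (p : E), B.ortho_mem p.2⟩

/-- The Rickart mapping `g ↦ g*` of `G` with respect to the compression base indexed by `B`:
`p ≤ g*` iff `g` commutes with `p` and the compression of `g` by `p` vanishes. -/
noncomputable def rickart (g : B.G) : Option B.carrier :=
  theUnique {r | ∀ p : B.carrier,
    UniversalGroup.LeG (UniversalGroup.of (B.incl p)) (UniversalGroup.of (B.incl r)) ↔
      g = B.extU p g + B.extU (B.compl p) g ∧ B.extU p g = 0}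

/-- The spectral projection `((n a - m u)_+)*` of `a ∈ C(B)`, as an element of `E`. -/
noncomputable def spectralProjection (a : B.cblock.carrier) (m : ℤ) (n : ℕ) : Option E := do
  let g ← UniversalGroup.pos (n • UniversalGroup.of a - m • UniversalGroup.of 1 : B.G)
  (B.rickart g).map Subtype.val

end Block

end CompressionBase

/-! Write `λ = k / 2 ^ N` with `k` odd (or `N = 0` at the two endpoints), and let `g = 2 ^ N a - k
u` in the universal group `G` of a C-block containing `a`. The projections `u_v`, for words `v` of
length `N`, form an orthogonal decomposition of `a°`. Each splitting step doubles `c_w` on `u_{w0}`,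
and doubles it and subtracts the unit on `u_{w1}`; hence on `u_v` the element `2 ^ N a` equals
`val(v) u_v + c_v`, where `c_v ≤ u_v` and `u_v` is the projection cover of `c_v` (`two_pow_nsmul`).
So `g` is negative on `u_v` when `val(v) < k`. When `val(v) ≥ k` it is positive there and, because
of the cover, vanishes on no nonzero projection below `u_v`. On `(a°)'` the element `a` vanishes, so
`g` is negative. Collecting the negative pieces gives exactly `p = p_λ`: `g` is negative on `p`
(`NegOn`) and strictly positive on `p'` (`PosOn`).

These two signs determine the rational projection: `g_+` is the part of `g` on `p'`, and the
projections of the block annihilating it are those below `p` (`spectralProjection_eq_some`). If `λ =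
m / n`, then `n a - m u` is a positive multiple of `g`, which changes nothing.

The argument needs the cone of `G` to be strict, with no nonzero element of the C-block dying in
`G`. For a totally ordered effect algebra `T` this holds because `G` acts on `ℤ × [0, 1)` by
translations that never lower the level. Comparability reduces the general case to this one: for `a
≠ 0`, the stalk of the C-block at a maximal filter of projections not annihilating `a` is totally
ordered, and `a` has a nonzero germ in it (`CentralFamily.eq_zero_of_of_add_eq_zero`). -/

theorem theUnique_eq_some {α : Type*} {S : Set α} {x : α} (hx : x ∈ S) (h : ∀ y ∈ S, y = x) :
    theUnique S = some x := by
  have hu : ∃! x, x ∈ S := ⟨x, hx, h⟩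
  unfold theUnique
  rw [dif_pos hu, Option.some.injEq]
  exact h _ hu.choose_spec.1

/-! ### Cancellation, order and orthosums in effect algebras. -/

namespace EffectAlgebra

section Order

variable {E : Type*} [EffectAlgebra E]

theorem exists_oplus_left_cancel {a b c : E} (h : oplus a b = some c) :
    ∃ f, oplus a (ortho c) = some f ∧ b = ortho f := by
  rw [oplus_comm] at h
  obtain ⟨f, hf, hf'⟩ := oplus_assoc _ _ _ _ _ h (oplus_ortho c)
  exact ⟨f, hf, eq_ortho _ _ (by rw [oplus_comm, hf'])⟩

theorem oplus_left_cancel {a b₁ b₂ c : E} (h₁ : oplus a b₁ = some c) (h₂ : oplus a b₂ = some c) :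
    b₁ = b₂ := by
  obtain ⟨f, hf, rfl⟩ := exists_oplus_left_cancel h₁
  obtain ⟨g, hg, rfl⟩ := exists_oplus_left_cancel h₂
  rw [Option.some.inj (hf.symm.trans hg)]

theorem oplus_right_cancel {a b₁ b₂ c : E} (h₁ : oplus b₁ a = some c) (h₂ : oplus b₂ a = some c) :
    b₁ = b₂ := by
  rw [oplus_comm] at h₁ h₂
  exact oplus_left_cancel h₁ h₂

theorem eq_zero_of_oplus_eq_self {a b : E} (h : oplus a b = some a) : b = 0 :=
  oplus_left_cancel h (oplus_zero a)

theorem eq_zero_of_oplus_eq_zero {a b : E} (h : oplus a b = some 0) : a = 0 := by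
  rw [oplus_comm] at h
  obtain ⟨f, hf, -⟩ := oplus_assoc _ _ _ _ _ h (zero_oplus 1)
  exact eq_zero_of_oplus_one _ _ hf

theorem Le.refl (a : E) : Le a a := ⟨0, oplus_zero a⟩

theorem le_left {a b c : E} (h : oplus a b = some c) : Le a c := ⟨b, h⟩

theorem le_right {a b c : E} (h : oplus a b = some c) : Le b c := ⟨a, by rw [oplus_comm, h]⟩

theorem Le.trans {a b c : E} : Le a b → Le b c → Le a c := by
  rintro ⟨x, hx⟩ ⟨y, hy⟩
  obtain ⟨f, -, hf⟩ := oplus_assoc _ _ _ _ _ hx hy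
  exact ⟨f, hf⟩

theorem Le.antisymm {a b : E} : Le a b → Le b a → a = b := by
  rintro ⟨x, hx⟩ ⟨y, hy⟩
  obtain ⟨f, hf, hf'⟩ := oplus_assoc _ _ _ _ _ hx hy
  rw [eq_zero_of_oplus_eq_self hf'] at hf
  rw [eq_zero_of_oplus_eq_zero hf, oplus_zero, Option.some.injEq] at hx
  exact hx

theorem zero_le (a : E) : Le 0 a := ⟨a, zero_oplus a⟩

theorem le_one (a : E) : Le a 1 := ⟨ortho a, oplus_ortho a⟩

theorem eq_zero_of_le_zero {a : E} (h : Le a 0) : a = 0 := h.antisymm (zero_le a)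

theorem exists_oplus_of_le_ortho {a b : E} : Le a (ortho b) → ∃ c, oplus a b = some c := by
  rintro ⟨x, hx⟩
  rw [oplus_comm] at hx
  obtain ⟨f, hf, -⟩ := oplus_assoc _ _ _ _ _ hx
    (show oplus (ortho b) b = some 1 by rw [oplus_comm, oplus_ortho])
  exact ⟨f, hf⟩

theorem le_ortho_comm {a b : E} (h : Le a (ortho b)) : Le b (ortho a) := by
  obtain ⟨c, hc⟩ := exists_oplus_of_le_ortho h
  rw [oplus_comm] at hc
  exact le_ortho_of_oplus hc

theorem Le.ortho {a b : E} (h : Le a b) : Le (ortho b) (ortho a) :=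
  le_ortho_comm (by rwa [ortho_ortho])

theorem exists_oplus_mono {a b c d s : E} (h : oplus b d = some s) (hab : Le a b) (hcd : Le c d) :
    ∃ t, oplus a c = some t ∧ Le t s := by
  obtain ⟨x, hx⟩ := hab
  obtain ⟨y, hy⟩ := hcd
  obtain ⟨v, w, hv, -, hs⟩ := oplus_exchange hx hy h
  exact ⟨v, hv, le_left hs⟩

theorem oplus_ortho_cancel {a b c : E} (h : oplus a b = some c) :
    ∃ f, oplus b (ortho c) = some f ∧ f = EffectAlgebra.ortho a := by
  obtain ⟨f, hf, hf'⟩ := oplus_assoc _ _ _ _ _ h (oplus_ortho c)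
  exact ⟨f, hf, eq_ortho _ _ hf'⟩

theorem ominus_eq_some {a b c : E} (h : oplus a c = some b) : ominus b a = some c :=
  theUnique_eq_some h fun _ hy => oplus_left_cancel hy h

theorem IsAdditive.map_zero {F : Type*} [EffectAlgebra F] {J : E → F} (hJ : IsAdditive J) :
    J 0 = 0 :=
  eq_zero_of_oplus_eq_self (hJ _ _ _ (oplus_zero 0))

theorem IsAdditive.mono {F : Type*} [EffectAlgebra F] {J : E → F} (hJ : IsAdditive J) {a b : E} :
    Le a b → Le (J a) (J b) := fun ⟨c, hc⟩ => ⟨J c, hJ _ _ _ hc⟩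

/-- An orthosum splits along a predicate on the index. -/
theorem osum_filter {ι : Type*} (f : ι → E) (P : ι → Bool) (l : List ι) {s : E}
    (h : osum (l.map f) = some s) :
    ∃ t t', osum ((l.filter P).map f) = some t ∧ osum ((l.filter fun i => !P i).map f) = some t' ∧
      oplus t t' = some s := by
  induction l generalizing s with
  | nil => exact ⟨0, 0, rfl, rfl, by rw [oplus_zero]; exact h⟩
  | cons x l ih =>
    simp only [List.map_cons, osum, Option.bind_eq_some_iff] at h
    obtain ⟨r, hr, hs⟩ := h
    obtain ⟨t, t', ht, ht', htt⟩ := ih hr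
    cases hP : P x with
    | true =>
      obtain ⟨d, hd, hd'⟩ := oplus_assoc' _ _ _ _ _ htt hs
      exact ⟨d, t', by simp [hP, osum, ht, hd], by simp [hP, ht'], hd'⟩
    | false =>
      rw [oplus_comm] at htt
      obtain ⟨d, hd, hd'⟩ := oplus_assoc' _ _ _ _ _ htt hs
      exact ⟨t, d, by simp [hP, ht], by simp [hP, osum, ht', hd], by rw [oplus_comm, hd']⟩

/-- A property that holds for `0` and is stable under `⊕` passes to orthosums. -/
theorem osum_induction {motive : E → Prop} (zero : motive 0)
    (oplus_mem : ∀ a b c, oplus a b = some c → motive a → motive b → motive c) :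
    ∀ (l : List E) (s : E), osum l = some s → (∀ x ∈ l, motive x) → motive s
  | [], s, h, _ => by rwa [← Option.some.inj h]
  | x :: l, s, h, hl => by
    simp only [osum, Option.bind_eq_some_iff] at h
    obtain ⟨t, ht, hs⟩ := h
    exact oplus_mem _ _ _ hs (hl x (by simp))
      (osum_induction zero oplus_mem l t ht fun y hy => hl y (by simp [hy]))

end Order

end EffectAlgebra

namespace SubEffectAlgebra

open EffectAlgebra

variable {E : Type*} [EffectAlgebra E] (F : SubEffectAlgebra E)

theorem zero_mem : (0 : E) ∈ F.carrier := ortho_one (E := E) ▸ F.ortho_mem 1 F.one_mem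

theorem of_oplus_mem {a b c : E} (h : oplus a b = some c) (ha : a ∈ F.carrier)
    (hc : c ∈ F.carrier) : b ∈ F.carrier := by
  obtain ⟨f, hf, rfl⟩ := exists_oplus_left_cancel h
  exact F.ortho_mem _ (F.oplus_mem _ ha _ (F.ortho_mem _ hc) _ hf)

theorem le_iff {a b : F.carrier} : Le a b ↔ Le (a : E) (b : E) := by
  constructor
  · rintro ⟨c, hc⟩
    exact ⟨c, (subOplus_eq F _ _ _).1 hc⟩
  · rintro ⟨c, hc⟩
    exact ⟨⟨c, F.of_oplus_mem hc a.2 b.2⟩, (subOplus_eq F _ _ _).2 hc⟩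

end SubEffectAlgebra

/-! ### Commutants, projection covers, positive parts and one splitting step. -/

namespace CompressionBase

open EffectAlgebra

variable {E : Type*} [EffectAlgebra E] {K : CompressionBase E}

theorem J_le {p : E} (hp : p ∈ K.P.carrier) (a : E) : Le (K.J p a) p := by
  have h := (additive hp).mono (le_one a)
  rwa [K.focus p hp] at h

theorem J_mono {p : E} (hp : p ∈ K.P.carrier) {a b : E} (h : Le a b) : Le (K.J p a) (K.J p b) :=
  (additive hp).mono h

theorem le_ortho_of_J_eq_zero {p : E} (hp : p ∈ K.P.carrier) {a : E} (h : K.J p a = 0) :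
    Le a (ortho p) := by
  have h' := ((K.isCompression p hp).2 a).1 h
  rwa [K.focus p hp] at h'

theorem J_J_mem {p q : E} (hp : p ∈ K.P.carrier) (hq : q ∈ K.P.carrier) (h : Compat p q) :
    K.J p q ∈ K.P.carrier ∧ ∀ x, K.J p (K.J q x) = K.J (K.J p q) x := by
  obtain ⟨r, hr, hr'⟩ := K.comp p hp q hq h
  have e : r = K.J p q := by rw [← K.focus r hr, ← hr', K.focus q hq]
  rw [← e]
  exact ⟨hr, hr'⟩

theorem compat_of_le {p q : E} : Le p q → Compat p q := fun ⟨d, hd⟩ =>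
  ⟨0, d, p, q, zero_oplus p, by rw [oplus_comm, hd], zero_oplus q⟩

theorem J_eq_of_le {p q : E} (hp : p ∈ K.P.carrier) (h : Le p q) : K.J p q = p := by
  have h1 := (additive hp) _ _ _ (oplus_ortho q)
  rw [J_eq_zero hp h.ortho, oplus_zero, K.focus p hp] at h1
  exact Option.some.inj h1

theorem J_J_of_le {p q : E} (hp : p ∈ K.P.carrier) (hq : q ∈ K.P.carrier) (h : Le p q) (x : E) :
    K.J p (K.J q x) = K.J p x := by
  rw [(J_J_mem hp hq (compat_of_le h)).2, J_eq_of_le hp h]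

theorem compat_of_mem_C {p a : E} (hp : p ∈ K.P.carrier) (h : a ∈ K.C p) : Compat p a := by
  apply compat_symm
  obtain ⟨d, hd⟩ := J_le hp a
  obtain ⟨s, hs⟩ := exists_oplus_of_le_ortho (J_le (K.P.ortho_mem p hp) a)
  exact ⟨K.J (ortho p) a, d, K.J p a, s, by rw [oplus_comm]; exact h, by rw [oplus_comm, hd], hs⟩

theorem mem_C_of_le {p a : E} (hp : p ∈ K.P.carrier) (h : Le a p) : a ∈ K.C p := by
  unfold C
  rw [Set.mem_ofPred_eq, J_eq_self hp h,
    J_eq_zero (K.P.ortho_mem p hp) (by rwa [ortho_ortho]), oplus_zero]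

/-- The commutant of a projection as a sub-effect algebra. -/
def commutant (p : E) (hp : p ∈ K.P.carrier) : SubEffectAlgebra E where
  carrier := K.C p
  one_mem := one_mem_C hp
  ortho_mem _ := ortho_mem_C hp
  oplus_mem _ ha _ hb _ h := oplus_mem_C hp ha hb h

theorem mem_C_of_oplus {p a b c : E} (hp : p ∈ K.P.carrier) (h : oplus a b = some c)
    (ha : a ∈ K.C p) (hc : c ∈ K.C p) : b ∈ K.C p :=
  (commutant p hp).of_oplus_mem h ha hc

theorem meet_eq_some {p b : E} (hp : p ∈ K.P.carrier) (hb : b ∈ K.C p) :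
    meet b p = some (K.J p b) := by
  have h : Le (K.J p b) b ∧ Le (K.J p b) p ∧ ∀ x, Le x b → Le x p → Le x (K.J p b) := by
    refine ⟨le_left hb, J_le hp b, fun x hxb hxp => ?_⟩
    have := J_mono hp hxb
    rwa [J_eq_self hp hxp] at this
  exact theUnique_eq_some h fun y hy => (h.2.2 y hy.1 hy.2.1).antisymm (hy.2.2 _ h.1 h.2.1)

theorem IsCover.mem {a p : E} (h : K.IsCover a p) : p ∈ K.P.carrier := h.1

theorem IsCover.le {a p : E} (h : K.IsCover a p) : Le a p := (h.2 p h.1).2 (Le.refl p)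

theorem IsCover.cover_eq {a p : E} (h : K.IsCover a p) : K.cover a = some p :=
  theUnique_eq_some h fun q hq => ((hq.2 p h.1).1 h.le).antisymm ((h.2 q hq.1).1 hq.le)

/-- If `a` splits along `q`, so does its cover: the covers of the two parts lie below `q` and `q'`,
and their orthosum `t` is the cover of `a`. It lies below `p` because `J_p` fixes both summands. -/
theorem IsCover.mem_C (hK : K.CoverProperty) {a p q : E} (h : K.IsCover a p)
    (hq : q ∈ K.P.carrier) (ha : a ∈ K.C q) : p ∈ K.C q := by
  have hq' := K.P.ortho_mem q hq
  obtain ⟨r, hr⟩ := hK (K.J q a)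
  obtain ⟨s, hs⟩ := hK (K.J (ortho q) a)
  have hrq : Le r q := (hr.2 q hq).1 (J_le hq a)
  have hsq : Le s (ortho q) := (hs.2 _ hq').1 (J_le hq' a)
  obtain ⟨t, ht⟩ := exists_oplus_of_le_ortho (hrq.trans (le_ortho_comm hsq))
  have htP := K.P.oplus_mem _ hr.mem _ hs.mem _ ht
  have hat : Le a t := by
    obtain ⟨a', ha', hle⟩ := exists_oplus_mono ht hr.le hs.le
    rwa [show a = a' from Option.some.inj (ha.symm.trans ha')]
  have hrp : Le r p := (hr.2 p h.1).1 ((le_left ha).trans h.le)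
  have hsp : Le s p := (hs.2 p h.1).1 ((le_right ha).trans h.le)
  have htp : Le t p := by
    have e := additive h.1 _ _ _ ht
    rw [J_eq_self h.1 hrp, J_eq_self h.1 hsp, ht, Option.some.injEq] at e
    rw [e]
    exact J_le h.1 t
  rw [((h.2 t htP).1 hat).antisymm htp]
  refine oplus_mem_C hq (mem_C_of_le hq hrq) ?_ ht
  have := ortho_mem_C hq' (ortho_mem_C hq' (mem_C_of_le hq' hsq))
  rw [ortho_ortho] at this
  unfold C at this ⊢
  rw [Set.mem_ofPred_eq, ortho_ortho, oplus_comm] at this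
  exact this

/-- If the cover `r` of `J_p(a)` left a remainder `t` in `p`, then `J_t(a) = 0`, so `a`, and with it
`u`, would lie below `t'`; but `t ≤ p ≤ u`, which forces `t = 0`. -/
theorem IsCover.J_of_le (hK : K.CoverProperty) {a u p : E} (h : K.IsCover a u)
    (hp : p ∈ K.P.carrier) (hpu : Le p u) : K.IsCover (K.J p a) p := by
  obtain ⟨r, hr⟩ := hK (K.J p a)
  obtain ⟨t, ht⟩ : Le r p := (hr.2 p hp).1 (J_le hp a)
  have htP : t ∈ K.P.carrier := K.P.of_oplus_mem ht hr.mem hp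
  have h1 : K.J t a = 0 := by
    rw [← J_J_of_le htP hp (le_right ht)]
    exact J_eq_zero htP (hr.le.trans (le_ortho_of_oplus ht))
  have h2 : Le u (ortho t) := (h.2 _ (K.P.ortho_mem t htP)).1 (le_ortho_of_J_eq_zero htP h1)
  have h3 : t = 0 := by
    rw [← J_eq_self htP (Le.refl t)]
    exact J_eq_zero htP ((le_right ht).trans (hpu.trans h2))
  rw [h3, oplus_zero, Option.some.injEq] at ht
  rwa [ht] at hr

theorem PC_ortho_pair (c : E) : K.PC {ortho c, c} = K.PC {c} := by
  ext q
  refine and_congr_right fun hq => ?_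
  simp only [Set.mem_insert_iff, Set.mem_singleton_iff, forall_eq_or_imp, forall_eq]
  exact and_iff_right_of_imp (ortho_mem_C hq)

theorem PC_ortho (c : E) : K.PC {ortho c} = K.PC {c} := by
  ext q
  refine and_congr_right fun hq => ?_
  simp only [Set.mem_singleton_iff, forall_eq]
  refine ⟨fun h => ?_, ortho_mem_C hq⟩
  rw [← ortho_ortho c]
  exact ortho_mem_C hq h

theorem mem_PC_of_mem_bicomm {A : Set E} {p : E} (hp : p ∈ K.bicomm A) : p ∈ K.PC A :=
  ⟨hp.1, fun a ha => hp.2 a (Or.inr ha)⟩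

theorem compat_of_mem_bicomm {A : Set E} {p q : E} (hp : p ∈ K.bicomm A) (hq : q ∈ K.PC A) :
    Compat p q :=
  compat_of_mem_C hp.1 (hp.2 q (Or.inl hq))

theorem commute_ortho (c : E) : K.Commute (ortho c) c := by
  intro p hp q hq
  have := mem_PC_of_mem_bicomm hq
  rw [← PC_ortho] at this
  exact compat_of_mem_bicomm hp this

/-- Independence of `p`: for `p, q ∈ P_≤(e, f)` both differences equal the difference of the images
under `J_p J_q`. The difference `x` taken on `p` lies below `q`, because on `q'` the inequality
between `e` and `f` is reversed and forces `J_{q'}(x) = 0`. -/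
theorem posPart_eq_some {e f p x : E} (hp : p ∈ K.PLe e f)
    (hx : oplus (K.J p e) x = some (K.J p f)) : K.posPart f e = some x := by
  have key : ∀ p q x, p ∈ K.PLe e f → q ∈ K.PLe e f → oplus (K.J p e) x = some (K.J p f) →
      oplus (K.J p (K.J q e)) x = some (K.J p (K.J q f)) := by
    intro p q x hp hq hx
    have hpP := hp.1.1
    have hqP := hq.1.1
    have hq' := K.P.ortho_mem q hqP
    have hc : Compat q p := compat_of_mem_bicomm hq.1 (mem_PC_of_mem_bicomm hp.1)
    have hxq : K.J (ortho q) x = 0 := by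
      have h1 := additive hq' _ _ _ hx
      have h2 := J_mono hpP hq.2.2
      rw [J_comm hpP hq' (compat_ortho (compat_symm hc)),
        J_comm hpP hq' (compat_ortho (compat_symm hc))] at h2
      rw [h2.antisymm (le_left h1)] at h1
      exact eq_zero_of_oplus_eq_self h1
    have hle := le_ortho_of_J_eq_zero hq' hxq
    rw [ortho_ortho] at hle
    have h3 := additive hqP _ _ _ hx
    rwa [J_eq_self hqP hle, J_comm hqP hpP hc, J_comm hqP hpP hc] at h3
  refine theUnique_eq_some ⟨p, hp, ominus_eq_some hx⟩ ?_
  rintro y ⟨q, hq, hy⟩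
  obtain ⟨d, hd⟩ := hq.2.1
  obtain rfl : d = y := Option.some.inj ((ominus_eq_some hd).symm.trans hy)
  have h1 := key p q x hp hq hx
  have h2 := key q p d hq hp hd
  have hc : Compat q p := compat_of_mem_bicomm hq.1 (mem_PC_of_mem_bicomm hp.1)
  rw [J_comm hq.1.1 hp.1.1 hc, J_comm hq.1.1 hp.1.1 hc] at h2
  exact oplus_left_cancel h2 h1

theorem ortho_mem_PLe {e f p : E} (hp : p ∈ K.PLe e f) : ortho p ∈ K.PLe f e := by
  obtain ⟨⟨hP, hb⟩, h1, h2⟩ := hp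
  have hP' := K.P.ortho_mem p hP
  refine ⟨?_, h2, by rwa [ortho_ortho]⟩
  rw [Set.pair_comm]
  refine ⟨hP', fun a ha => ?_⟩
  have := hb a ha
  unfold C at this ⊢
  rwa [Set.mem_ofPred_eq, ortho_ortho, oplus_comm]

/-- One step of the binary spectral resolution. -/
theorem exists_splitStep (hK : K.Spectral) {c u : E} (hu : K.IsCover c u) :
    ∃ c₀ u₀ c₁ u₁, K.splitStep (c, u) false = some (c₀, u₀) ∧
      K.splitStep (c, u) true = some (c₁, u₁) ∧ K.IsCover c₀ u₀ ∧ K.IsCover c₁ u₁ ∧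
      oplus u₀ u₁ = some u ∧ oplus (K.J u₀ c) (K.J u₀ c) = some c₀ ∧
      (∃ d, oplus c₁ d = some (K.J u₁ c) ∧ oplus d (K.J u₁ c) = some u₁) ∧
      ∀ q ∈ K.PC {c}, c₀ ∈ K.C q ∧ c₁ ∈ K.C q := by
  obtain ⟨p, hp⟩ := hK.1.2 (ortho c) c (commute_ortho c)
  have hcP := hK.2
  have hpP := hp.1.1
  have hpP' := K.P.ortho_mem p hpP
  have huP := hu.mem
  have hcu : c ∈ K.C u := mem_C_of_le huP hu.le
  have hcp : c ∈ K.C p := hp.1.2 c (Or.inr (Or.inr rfl))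
  obtain ⟨pos, hpos⟩ := hp.2.1
  obtain ⟨neg, hneg⟩ := hp.2.2
  have hpos' := posPart_eq_some hp hpos
  have hneg' := posPart_eq_some (ortho_mem_PLe hp) hneg
  obtain ⟨e, he⟩ := hcP pos
  have heP := he.mem
  have heP' := K.P.ortho_mem e heP
  have hposp : Le pos p := (le_right hpos).trans (J_le hpP c)
  have hposu : Le pos u := ((le_right hpos).trans (le_left hcp)).trans hu.le
  have hnegp : Le neg (ortho p) := (le_right hneg).trans (J_le hpP' _)
  have hep : Le e p := (he.2 p hpP).1 hposp
  obtain ⟨u₀, hu₀⟩ : Le e u := (he.2 u huP).1 hposu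
  have heu : Le e u := le_left hu₀
  have hu₀u : Le u₀ u := le_right hu₀
  have hu₀P : u₀ ∈ K.P.carrier := K.P.of_oplus_mem hu₀ heP huP
  have hu₀P' := K.P.ortho_mem u₀ hu₀P
  have hu₀e : Le u₀ (ortho e) := le_ortho_comm (le_ortho_of_oplus hu₀)
  have heu₀ : Le e (ortho u₀) := le_ortho_comm hu₀e
  have hcompu : ∀ q ∈ K.PC {c}, Compat q p := fun q hq => compat_symm
    (compat_of_mem_bicomm hp.1 (by rwa [PC_ortho_pair]))
  have hcomm : ∀ q ∈ K.PC {c}, pos ∈ K.C q ∧ neg ∈ K.C q := by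
    intro q hq
    have hc : c ∈ K.C q := hq.2 c rfl
    have hc' := ortho_mem_C hq.1 hc
    have hpq := compat_symm (hcompu q hq)
    have hpq' := compat_symm (compat_ortho (hcompu q hq))
    exact ⟨mem_C_of_oplus hq.1 hpos (J_mem_C hpP hq.1 hpq hc') (J_mem_C hpP hq.1 hpq hc),
      mem_C_of_oplus hq.1 hneg (J_mem_C hpP' hq.1 hpq' hc) (J_mem_C hpP' hq.1 hpq' hc')⟩
  have huPC : u ∈ K.PC {c} := ⟨huP, fun a ha => by rwa [Set.mem_singleton_iff.1 ha]⟩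
  -- the four meets
  have hJue : K.J u (ortho e) = u₀ := by
    have h1 := additive huP _ _ _ (oplus_ortho e)
    rw [J_eq_self huP heu, K.focus u huP] at h1
    exact oplus_left_cancel h1 hu₀
  have hm0 : meet (ortho e) u = some u₀ := by
    rw [meet_eq_some huP (ortho_mem_C huP (mem_C_of_le huP heu)), hJue]
  have hm1 : meet u (ortho u₀) = some e := by
    have h1 := additive hu₀P' _ _ _ hu₀
    rw [J_eq_self hu₀P' heu₀, J_eq_zero hu₀P' (by rw [ortho_ortho]; exact Le.refl u₀),
      oplus_zero, Option.some.injEq] at h1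
    rw [meet_eq_some hu₀P' (mem_C_of_compat hu₀P' (compat_symm
      (compat_ortho (compat_symm (compat_of_le hu₀u))))), ← h1]
  have hmpos : meet pos u = some pos := by
    rw [meet_eq_some huP (mem_C_of_le huP hposu), J_eq_self huP hposu]
  -- Since `neg ≤ p' ≤ e'`, compressing by `u` amounts to compressing by `u ∧ e' = u₀`.
  have hmneg : meet neg u = some (K.J u₀ neg) := by
    rw [meet_eq_some huP (hcomm u huPC).2, ← hJue,
      ← (J_J_mem huP heP' (compat_ortho (compat_symm (compat_of_le heu)))).2,
      J_eq_self heP' (hnegp.trans hep.ortho)]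
  -- the lower half
  have hsum : oplus (K.J u₀ c) (K.J u₀ (ortho c)) = some u₀ := by
    have := additive hu₀P _ _ _ (oplus_ortho c)
    rwa [K.focus u₀ hu₀P] at this
  -- On `u₀` the positive part vanishes, so `c` and `c'` agree on the `p` component there and differ
  -- by `neg` on the `p'` component.
  have hu₀neg : oplus (K.J u₀ c) (K.J u₀ neg) = some (K.J u₀ (ortho c)) := by
    have h1 := additive hu₀P _ _ _ hpos
    rw [J_eq_zero hu₀P (he.le.trans heu₀), oplus_zero, Option.some.injEq] at h1
    have h2 := additive hu₀P _ _ _ hneg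
    have h3 := additive hu₀P _ _ _ hcp
    have h4 := additive hu₀P _ _ _ (ortho_mem_C hpP hcp)
    rw [h1] at h4
    obtain ⟨d, hd, hd'⟩ := oplus_assoc' _ _ _ _ _ h2 h4
    rw [h3] at hd
    rwa [Option.some.inj hd]
  -- Here `u₀` is `J_{u₀}(c)` plus `J_{u₀}(c')`, and the latter is `J_{u₀}(c)` plus `J_{u₀}(neg)`;
  -- removing `J_{u₀}(neg)` leaves twice `J_{u₀}(c)`.
  obtain ⟨c₀, hc₀, hc₀'⟩ := oplus_assoc' _ _ _ _ _ hu₀neg hsum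
  rw [oplus_comm] at hc₀'
  have hcov₀ := hu.J_of_le hcP hu₀P hu₀u
  -- the upper half
  have hec : oplus (K.J e (ortho c)) pos = some (K.J e c) := by
    have h1 := additive heP _ _ _ hpos
    rwa [J_J_of_le heP hpP hep, J_J_of_le heP hpP hep, J_eq_self heP he.le] at h1
  have hec' : oplus (K.J e (ortho c)) (K.J e c) = some e := by
    have := additive heP _ _ _ (oplus_ortho c)
    rwa [K.focus e heP, oplus_comm] at this
  have hstep : ∀ b, K.splitStep (c, u) b = if b then some (pos, e) else some (c₀, u₀) := by
    intro b
    simp only [splitStep, hpos', hneg', he.cover_eq, hm0, hm1, hmpos, hmneg,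
      ominus_eq_some hc₀', Option.bind_eq_bind, Option.bind_some]
  refine ⟨c₀, u₀, pos, e, by simp [hstep], by simp [hstep], ⟨hu₀P, fun q hq => ?_⟩, he,
    by rw [oplus_comm, hu₀], hc₀, ⟨_, by rw [oplus_comm, hec], hec'⟩,
    fun q hq => ⟨?_, (hcomm q hq).1⟩⟩
  -- A projection dominates `c₀`, the double of `J_{u₀}(c)`, exactly when it dominates `J_{u₀}(c)`,
  -- whose cover is `u₀`.
  · rw [← hcov₀.2 q hq]
    refine ⟨(le_left hc₀).trans, fun h => ?_⟩
    have h1 := additive hq _ _ _ hc₀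
    rw [J_eq_self hq h, hc₀, Option.some.injEq] at h1
    rw [h1]
    exact J_le hq c₀
  · have hu₀q : u₀ ∈ K.C q := mem_C_of_oplus hq.1 hu₀ (he.mem_C hcP hq.1 (hcomm q hq).1)
      (hu.mem_C hcP hq.1 (hq.2 c rfl))
    have hcq := J_mem_C hu₀P hq.1 (compat_symm (compat_of_mem_C hq.1 hu₀q)) (hq.2 c rfl)
    exact oplus_mem_C hq.1 hcq hcq hc₀

end CompressionBase

/-! ### Binary words and dyadic rationals. -/

/-- The natural number with binary expansion `w`. -/
def wordValue : List Bool → ℕ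
  | [] => 0
  | b :: w => b.toNat * 2 ^ w.length + wordValue w

theorem wordValue_lt (w : List Bool) : wordValue w < 2 ^ w.length := by
  induction w with
  | nil => simp [wordValue]
  | cons b w ih =>
    rw [wordValue, List.length_cons, pow_succ]
    cases b
    · rw [Bool.toNat_false]
      omega
    · rw [Bool.toNat_true]
      omega

theorem wordValue_append (w : List Bool) (b : Bool) :
    wordValue (w ++ [b]) = 2 * wordValue w + b.toNat := by
  induction w with
  | nil => simp [wordValue]
  | cons c w ih =>
    rw [List.cons_append, wordValue, ih, wordValue, List.length_append, List.length_singleton,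
      pow_succ]
    ring

theorem exists_wordValue_eq (n j : ℕ) (h : j < 2 ^ n) :
    ∃ w : List Bool, w.length = n ∧ wordValue w = j := by
  induction n generalizing j with
  | zero => exact ⟨[], rfl, by rw [wordValue]; omega⟩
  | succ n ih =>
    obtain ⟨w, hw, hw'⟩ := ih (j / 2) (by rw [pow_succ] at h; omega)
    refine ⟨w ++ [decide (j % 2 = 1)], by simp [hw], ?_⟩
    rw [wordValue_append, hw']
    by_cases hj : j % 2 = 1
    · rw [decide_eq_true hj, Bool.toNat_true]
      omega
    · rw [decide_eq_false hj, Bool.toNat_false]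
      omega

theorem word_lt_iff {v w : List Bool} (h : v.length = w.length) :
    v < w ↔ wordValue v < wordValue w := by
  induction v generalizing w with
  | nil =>
    obtain rfl := List.length_eq_zero_iff.1 h.symm
    simp
  | cons b v ih =>
    match w, h with
    | c :: w, h =>
      have h' : v.length = w.length := by simpa using h
      have h1 := wordValue_lt v
      have h2 := wordValue_lt w
      rw [List.cons_lt_cons_iff, ih h', wordValue, wordValue, h']
      rw [h'] at h1
      cases b <;> cases c <;> simp [Bool.lt_iff] <;> omega

theorem word_le_iff {v w : List Bool} (h : v.length = w.length) :
    v ≤ w ↔ wordValue v ≤ wordValue w := by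
  rw [← not_lt, word_lt_iff h.symm, not_lt]

theorem dyadicValue_cons (b : Bool) (w : List Bool) :
    dyadicValue (b :: w) = ((b.toNat : ℚ) + dyadicValue w) / 2 := by
  have h : dyadicValue (b :: w) = ∑ j : Fin (w.length + 1),
      (if (b :: w)[j] then (1 : ℚ) else 0) / 2 ^ ((j : ℕ) + 1) := rfl
  rw [h, Fin.sum_univ_succ, add_div, dyadicValue, Finset.sum_div]
  congr 1
  · cases b <;> simp
  · refine Finset.sum_congr rfl fun j _ => ?_
    rw [Fin.val_succ, pow_succ _ ((j : ℕ) + 1), div_div]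
    rfl

theorem dyadicValue_eq (w : List Bool) : dyadicValue w = wordValue w / 2 ^ w.length := by
  induction w with
  | nil => simp [dyadicValue, wordValue]
  | cons b w ih =>
    rw [dyadicValue_cons, ih, wordValue, List.length_cons, pow_succ]
    push_cast
    field_simp

theorem dyadicValue_append_true (w : List Bool) :
    dyadicValue (w ++ [true]) = (2 * wordValue w + 1 : ℕ) / 2 ^ (w.length + 1) := by
  rw [dyadicValue_eq, wordValue_append, List.length_append, List.length_singleton, Bool.toNat_true]

theorem dyadicValue_append_true_pos (w : List Bool) : 0 < dyadicValue (w ++ [true]) := by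
  rw [dyadicValue_append_true]
  positivity

theorem dyadicValue_lt_one (w : List Bool) : dyadicValue w < 1 := by
  rw [dyadicValue_eq, div_lt_one (by positivity)]
  exact_mod_cast wordValue_lt w

/-- The empty word gives `1/2`, and the first bit of any other word decides on which side of `1/2`
the value lies; this allows induction on the word. It is what makes `p_λ` single-valued. -/
theorem dyadicValue_append_true_injective :
    Function.Injective fun w : List Bool => dyadicValue (w ++ [true]) := by
  intro v w h
  simp only at h
  induction v generalizing w with
  | nil =>
    cases w with
    | nil => rfl
    | cons c w =>
      rw [List.cons_append, dyadicValue_cons, List.nil_append, dyadicValue_cons] at h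
      have h1 := dyadicValue_append_true_pos w
      have h2 := dyadicValue_lt_one (w ++ [true])
      have h0 : dyadicValue [] = 0 := by simp [dyadicValue]
      rw [h0] at h
      cases c <;> norm_num at h <;> linarith
  | cons b v ih =>
    have h1 := dyadicValue_append_true_pos v
    have h2 := dyadicValue_lt_one (v ++ [true])
    cases w with
    | nil =>
      rw [List.cons_append, dyadicValue_cons, List.nil_append, dyadicValue_cons] at h
      have h0 : dyadicValue [] = 0 := by simp [dyadicValue]
      rw [h0] at h
      cases b <;> norm_num at h <;> linarith
    | cons c w =>
      rw [List.cons_append, dyadicValue_cons, List.cons_append, dyadicValue_cons] at h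
      have h3 := dyadicValue_append_true_pos w
      have h4 := dyadicValue_lt_one (w ++ [true])
      have hbc : b = c := by
        cases b <;> cases c <;> norm_num at h ⊢ <;> linarith
      subst hbc
      rw [ih (add_left_cancel ((div_left_inj' two_ne_zero).1 h))]

/-- Factors of two are cancelled until the numerator is odd, `2j + 1`, or the denominator is `1`;
the word is the binary expansion of `j`. -/
theorem dyadic_cases {l : ℚ} (h : ∃ (k : ℤ) (i : ℕ), l = k / 2 ^ i) (h0 : 0 ≤ l) (h1 : l ≤ 1) :
    l = 0 ∨ l = 1 ∨ ∃ w : List Bool, l = dyadicValue (w ++ [true]) := by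
  obtain ⟨k, i, h⟩ := h
  lift k to ℕ using (by
    rw [h, le_div_iff₀ (by positivity), zero_mul] at h0
    exact_mod_cast h0)
  rw [Int.cast_natCast] at h
  induction i generalizing k with
  | zero =>
    rw [pow_zero, div_one] at h
    have : k ≤ 1 := by rw [h] at h1; exact_mod_cast h1
    interval_cases k
    · exact Or.inl (by simpa using h)
    · exact Or.inr (Or.inl (by simpa using h))
  | succ i ih =>
    rcases Nat.even_or_odd' k with ⟨j, rfl | rfl⟩
    · refine ih j ?_
      rw [h, pow_succ]
      push_cast
      field_simp
    · have hj : j < 2 ^ i := by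
        rw [h, div_le_one (by positivity), pow_succ] at h1
        have : 2 * j + 1 ≤ 2 ^ i * 2 := by exact_mod_cast h1
        omega
      obtain ⟨w, hw, hw'⟩ := exists_wordValue_eq i j hj
      exact Or.inr (Or.inr ⟨w, by rw [dyadicValue_append_true, hw, hw', h]⟩)

theorem length_of_mem_binaryWords {n : ℕ} {w : List Bool} (h : w ∈ binaryWords n) :
    w.length = n := by
  induction n generalizing w with
  | zero => simp_all [binaryWords]
  | succ n ih =>
    simp only [binaryWords, List.mem_flatMap] at h
    obtain ⟨v, hv, hw⟩ := h
    have := ih hv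
    rcases List.mem_pair.1 hw with rfl | rfl <;> simpa

/-! ### Existence of the binary spectral resolution. -/

namespace EffectAlgebra

variable {E : Type*} [EffectAlgebra E]

theorem osum_binaryWords {u : List Bool → E}
    (hu : ∀ w, oplus (u (w ++ [false])) (u (w ++ [true])) = some (u w)) (n : ℕ) :
    osum ((binaryWords n).map u) = some (u []) := by
  have key : ∀ (l : List (List Bool)) (s : E), osum (l.map u) = some s →
      osum ((l.flatMap fun w => [w ++ [false], w ++ [true]]).map u) = some s := by
    intro l
    induction l with
    | nil => exact fun s hs => hs
    | cons w l ih =>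
      intro s hs
      simp only [List.map_cons, osum, Option.bind_eq_some_iff] at hs
      obtain ⟨t, ht, hs⟩ := hs
      obtain ⟨f, hf, hf'⟩ := oplus_assoc _ _ _ _ _ (hu w) hs
      simp [osum, ih t ht, hf, hf']
  induction n with
  | zero => simp [binaryWords, osum, oplus_zero]
  | succ n ih => exact key _ _ ih

end EffectAlgebra

theorem mapM_eq_some {α β : Type*} {f : α → Option β} {g : α → β} (h : ∀ x, f x = some (g x))
    (l : List α) : l.mapM f = some (l.map g) := by
  rw [funext h]
  exact List.mapM_pure

namespace CompressionBase

open EffectAlgebra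

variable {E : Type*} [EffectAlgebra E] {K : CompressionBase E}

theorem splitting_append (a : E) (w : List Bool) (b : Bool) :
    K.splitting a (w ++ [b]) = (K.splitting a w).bind fun s => K.splitStep s b := by
  unfold splitting
  cases K.cover a with
  | none => rfl
  | some e => simp [List.foldlM_append]

/-- `c` and `u` are the elements `c_w` and `u_w` of the binary spectral resolution of `a`, with
their characteristic relations. -/
structure IsSplitting (K : CompressionBase E) (a : E) (c u : List Bool → E) : Prop where
  splitting_eq : ∀ w, K.splitting a w = some (c w, u w)
  c_nil : c [] = a
  isCover : ∀ w, K.IsCover (c w) (u w)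
  mem_C : ∀ w, ∀ q ∈ K.PC {a}, c w ∈ K.C q
  oplus_u : ∀ w, oplus (u (w ++ [false])) (u (w ++ [true])) = some (u w)
  c_false : ∀ w, oplus (K.J (u (w ++ [false])) (c w)) (K.J (u (w ++ [false])) (c w)) =
    some (c (w ++ [false]))
  c_true : ∀ w, ∃ d, oplus (c (w ++ [true])) d = some (K.J (u (w ++ [true])) (c w)) ∧
    oplus d (K.J (u (w ++ [true])) (c w)) = some (u (w ++ [true]))

theorem exists_isSplitting (hK : K.Spectral) (a : E) : ∃ c u, K.IsSplitting a c u := by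
  -- The cover relation is what the next splitting step requires; commutation with all of `PC({a})`
  -- later places `c_w` in every C-block containing `a`.
  have key : ∀ w, ∃ s, K.splitting a w = some s ∧ K.IsCover s.1 s.2 ∧
      ∀ q ∈ K.PC {a}, s.1 ∈ K.C q := by
    intro w
    induction w using List.reverseRecOn with
    | nil =>
      obtain ⟨e, he⟩ := hK.2 a
      refine ⟨(a, e), ?_, he, fun q hq => hq.2 a rfl⟩
      simp [splitting, he.cover_eq]
    | append_singleton w b ih =>
      obtain ⟨s, hs, hcov, hs'⟩ := ih
      obtain ⟨c₀, u₀, c₁, u₁, h0, h1, hc0, hc1, -, -, -, h⟩ := exists_splitStep hK hcov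
      have hmem : ∀ q ∈ K.PC {a}, q ∈ K.PC {s.1} := fun q hq =>
        ⟨hq.1, fun x hx => by rw [Set.mem_singleton_iff.1 hx]; exact hs' q hq⟩
      rw [splitting_append, hs]
      cases b with
      | false => exact ⟨_, h0, hc0, fun q hq => (h q (hmem q hq)).1⟩
      | true => exact ⟨_, h1, hc1, fun q hq => (h q (hmem q hq)).2⟩
  choose s hs hcov hmem using key
  have step : ∀ w b, K.splitStep (s w) b = some (s (w ++ [b])) := by
    intro w b
    have := hs (w ++ [b])
    rwa [splitting_append, hs, Option.bind_some] at this
  have rel := fun w => exists_splitStep hK (hcov w)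
  have hnil : s [] = (a, (s []).2) := by
    obtain ⟨e, he⟩ := hK.2 a
    have := hs []
    simp only [splitting, he.cover_eq, Option.bind_eq_bind, Option.bind_some, List.foldlM_nil,
      Option.pure_def, Option.some.injEq] at this
    rw [← this]
  refine ⟨fun w => (s w).1, fun w => (s w).2, hs, by rw [hnil], hcov, hmem, fun w => ?_,
    fun w => ?_, fun w => ?_⟩ <;>
  · obtain ⟨c₀, u₀, c₁, u₁, h0, h1, -, -, h2, h3, h4, -⟩ := rel w
    have e0 := Option.some.inj ((step w false).symm.trans h0)
    have e1 := Option.some.inj ((step w true).symm.trans h1)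
    simp only [e0, e1]
    assumption

theorem IsSplitting.u_mem_P {a : E} {c u : List Bool → E} (h : K.IsSplitting a c u) (w : List Bool) :
    u w ∈ K.P.carrier :=
  (h.isCover w).mem

/-- All `u_v` of one length sum to `a°`, so the words above `w0` contribute precisely `p'`. This
describes both sides of `p`, as the sign analysis requires. -/
theorem IsSplitting.exists_midProjection {a : E} {c u : List Bool → E} (h : K.IsSplitting a c u)
    (w : List Bool) :
    ∃ t p, K.midProjection a w = some p ∧ oplus (ortho (u [])) t = some p ∧
      osum (((binaryWords (w.length + 1)).filter (fun v => v ≤ w ++ [false])).map u) = some t ∧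
      osum (((binaryWords (w.length + 1)).filter (fun v => !decide (v ≤ w ++ [false]))).map u) =
        some (ortho p) := by
  obtain ⟨t, t', ht, ht', htt⟩ := osum_filter u (fun v => v ≤ w ++ [false]) _
    (osum_binaryWords h.oplus_u (w.length + 1))
  have hu := h.isCover []
  rw [h.c_nil] at hu
  have h1 : oplus (ortho (u [])) (u []) = some 1 := by rw [oplus_comm, oplus_ortho]
  obtain ⟨p, hp, hp'⟩ := oplus_assoc' _ _ _ _ _ htt h1
  refine ⟨t, p, ?_, hp, ht, by rw [ht', eq_ortho _ _ hp']⟩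
  have hm := mapM_eq_some (f := fun v => (K.splitting a v).map Prod.snd) (g := u)
    (fun v => by rw [h.splitting_eq]; rfl)
  simp only [midProjection, hu.cover_eq, hm, Option.bind_eq_bind, Option.bind_some, ht, hp]

theorem binaryResolution_dyadicValue {a p : E} {w : List Bool}
    (h : K.midProjection a w = some p) :
    K.binaryResolution a (dyadicValue (w ++ [true])) = some p := by
  have h1 := dyadicValue_append_true_pos w
  have h2 := dyadicValue_lt_one (w ++ [true])
  refine theUnique_eq_some (Or.inr (Or.inr ⟨w, rfl, h⟩)) ?_
  rintro y (⟨hy, -⟩ | ⟨hy, -⟩ | ⟨v, hv, hy⟩)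
  · exact absurd hy h1.ne'
  · exact absurd hy h2.ne
  · rw [← dyadicValue_append_true_injective hv, h] at hy
    exact (Option.some.inj hy).symm

theorem binaryResolution_zero {a e : E} (h : K.IsCover a e) :
    K.binaryResolution a 0 = some (ortho e) := by
  refine theUnique_eq_some (Or.inl ⟨rfl, by rw [h.cover_eq]; rfl⟩) ?_
  rintro y (⟨-, hy⟩ | ⟨hy, -⟩ | ⟨v, hv, -⟩)
  · rw [h.cover_eq] at hy
    exact (Option.some.inj hy).symm
  · exact absurd hy zero_ne_one
  · exact absurd hv (dyadicValue_append_true_pos v).ne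

theorem binaryResolution_one (a : E) : K.binaryResolution a 1 = some 1 := by
  refine theUnique_eq_some (Or.inr (Or.inl ⟨rfl, rfl⟩)) ?_
  rintro y (⟨hy, -⟩ | ⟨-, hy⟩ | ⟨v, hv, -⟩)
  · exact absurd hy one_ne_zero
  · exact hy
  · exact absurd hv (dyadicValue_lt_one _).ne'

end CompressionBase

/-! ### The universal group of a totally ordered effect algebra. -/

namespace EffectAlgebra

namespace UniversalGroup

section Lift

variable {A : Type*} [EffectAlgebra A]

/-- The universal property of the universal group. -/
def lift {H : Type*} [AddCommGroup H] (f : A → H)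
    (hf : ∀ a b c, oplus a b = some c → f c = f a + f b) : UniversalGroup A →+ H :=
  QuotientAddGroup.lift _ (FreeAbelianGroup.lift f) (by
    unfold universalRelations
    rw [AddSubgroup.closure_le]
    rintro x ⟨a, b, c, h, rfl⟩
    simp [hf a b c h])

theorem lift_of {H : Type*} [AddCommGroup H] (f : A → H)
    (hf : ∀ a b c, oplus a b = some c → f c = f a + f b) (a : A) : lift f hf (of a) = f a := by
  simp [lift, of]

theorem of_oplus {a b c : A} (h : oplus a b = some c) : of c = of a + of b := by
  unfold of
  rw [← QuotientAddGroup.mk_add, QuotientAddGroup.eq, neg_add_eq_sub, ← neg_sub]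
  exact neg_mem (AddSubgroup.subset_closure ⟨a, b, c, h, rfl⟩)

theorem of_zero : of (0 : A) = 0 := by
  have h := of_oplus (zero_oplus (0 : A))
  simpa using h

theorem of_mem_cone (a : A) : of a ∈ cone A := AddSubmonoid.subset_closure ⟨a, rfl⟩

theorem map_mem_cone {A' : Type _} [EffectAlgebra A'] {J : A → A'} (hJ : IsAdditive J)
    {x : UniversalGroup A} (hx : x ∈ cone A) : map J hJ x ∈ cone A' := by
  unfold cone at hx
  induction hx using AddSubmonoid.closure_induction with
  | mem x hx =>
    obtain ⟨a, rfl⟩ := hx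
    rw [map_of]
    exact of_mem_cone _
  | zero => simp
  | add x y _ _ hx hy =>
    rw [map_add]
    exact add_mem hx hy

end Lift

end UniversalGroup

section Chain

variable {T : Type*} [EffectAlgebra T]

/-- The graph of the translation by `a` on `ℤ × [0, 1)`. -/
def Shift (a : T) (x y : ℤ × {t : T // t ≠ 1}) : Prop :=
  (y.1 = x.1 ∧ oplus (x.2 : T) a = some (y.2 : T)) ∨
    (y.1 = x.1 + 1 ∧ oplus (y.2 : T) (ortho a) = some (x.2 : T))

/-- A pair `(n, s)` stands for `n + s`. If both the sum and the carry were possible, then `z ⊕ 1`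
would be defined, so `z = 0` and `x ⊕ a = 1`, a value excluded from `[0, 1)`. -/
theorem Shift.unique {a : T} {x y z : ℤ × {t : T // t ≠ 1}} (hy : Shift a x y)
    (hz : Shift a x z) : y = z := by
  have key : ∀ y z : ℤ × {t : T // t ≠ 1}, oplus (x.2 : T) a = some (y.2 : T) →
      oplus (z.2 : T) (ortho a) = some (x.2 : T) → False := by
    intro y z h1 h2
    obtain ⟨f, hf, hf'⟩ := oplus_assoc _ _ _ _ _ h2 h1
    rw [oplus_comm, oplus_ortho, Option.some.injEq] at hf
    rw [← hf] at hf'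
    rw [eq_zero_of_oplus_one _ _ hf', zero_oplus, Option.some.injEq] at hf'
    exact y.2.2 hf'.symm
  rcases hy with ⟨h1, h2⟩ | ⟨h1, h2⟩ <;> rcases hz with ⟨h3, h4⟩ | ⟨h3, h4⟩
  · exact Prod.ext (h1.trans h3.symm) (Subtype.ext (Option.some.inj (h2.symm.trans h4)))
  · exact (key y z h2 h4).elim
  · exact (key z y h4 h2).elim
  · exact Prod.ext (h1.trans h3.symm) (Subtype.ext (oplus_right_cancel h2 h4))

theorem exists_shift (htot : ∀ a b : T, Le a b ∨ Le b a) (a : T) (x : ℤ × {t : T // t ≠ 1}) :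
    ∃ y, Shift a x y := by
  obtain ⟨n, s, hs⟩ := x
  rcases htot s (ortho a) with h | ⟨d, hd⟩
  · obtain ⟨r, hr⟩ := exists_oplus_of_le_ortho h
    by_cases hr1 : r = 1
    · have h0 : (0 : T) ≠ 1 := fun h0 => hs ((le_one s).antisymm (h0 ▸ zero_le s))
      refine ⟨(n + 1, ⟨0, h0⟩), Or.inr ⟨rfl, ?_⟩⟩
      rw [hr1, oplus_comm] at hr
      exact (zero_oplus _).trans (congrArg some (eq_ortho _ _ hr).symm)
    · exact ⟨(n, ⟨r, hr1⟩), Or.inl ⟨rfl, hr⟩⟩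
  · refine ⟨(n + 1, ⟨d, fun h => hs ?_⟩), Or.inr ⟨rfl, (oplus_comm _ _).trans hd⟩⟩
    exact (le_one s).antisymm (h ▸ le_right hd)

/-- Translating by `a` and then by `a'` raises the level by one; hence translation by `a'`, lowered
one level, inverts translation by `a`. -/
theorem shift_ortho_iff {a : T} {x y : ℤ × {t : T // t ≠ 1}} :
    Shift (ortho a) y (x.1 + 1, x.2) ↔ Shift a x y := by
  unfold Shift
  rw [ortho_ortho, or_comm, add_left_inj, eq_comm (a := x.1), eq_comm (b := y.1)]

/-- The four cases count the carries. Two carries cannot occur when `a ⊕ b` exists: they would give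
`a = b'` and force the starting point to be `1`. -/
theorem Shift.comp {a b c : T} (hc : oplus a b = some c) {x y z : ℤ × {t : T // t ≠ 1}}
    (hxy : Shift a x y) (hyz : Shift b y z) : Shift c x z := by
  obtain ⟨f, hf, rfl⟩ := oplus_ortho_cancel hc
  obtain ⟨g, hg, rfl⟩ := oplus_ortho_cancel (show oplus b a = some c by rw [oplus_comm, hc])
  rcases hxy with ⟨h1, h2⟩ | ⟨h1, h2⟩ <;> rcases hyz with ⟨h3, h4⟩ | ⟨h3, h4⟩
  · obtain ⟨r, hr, hr'⟩ := oplus_assoc _ _ _ _ _ h2 h4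
    rw [hc, Option.some.injEq] at hr
    exact Or.inl ⟨h3.trans h1, hr ▸ hr'⟩
  · rw [oplus_comm] at hg
    obtain ⟨r, hr, hr'⟩ := oplus_assoc' _ _ _ _ _ hg h4
    exact Or.inr ⟨h3.trans (by rw [h1]), by rwa [oplus_right_cancel hr' h2] at hr⟩
  · obtain ⟨r, hr, hr'⟩ := oplus_assoc' _ _ _ _ _ hf h2
    rw [h4, Option.some.injEq] at hr
    exact Or.inr ⟨h3.trans h1, hr ▸ hr'⟩
  · exfalso
    obtain ⟨r, hr, hr'⟩ := oplus_assoc _ _ _ _ _ h4 h2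
    have hab : a = ortho b :=
      (le_ortho_of_oplus hc).antisymm (by simpa [ortho_ortho] using le_ortho_of_oplus hr)
    rw [hab, oplus_ortho, Option.some.injEq] at hr
    rw [← hr] at hr'
    rw [eq_zero_of_oplus_one _ _ hr', zero_oplus, Option.some.injEq] at hr'
    exact x.2.2 hr'.symm

/-- The translation by `a` on `ℤ × [0, 1)`, for a totally ordered effect algebra. -/
noncomputable def translation (htot : ∀ a b : T, Le a b ∨ Le b a) (a : T) :
    Equiv.Perm (ℤ × {t : T // t ≠ 1}) where
  toFun x := (exists_shift htot a x).choose
  invFun y := ((exists_shift htot (ortho a) y).choose.1 - 1,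
    (exists_shift htot (ortho a) y).choose.2)
  left_inv x := by
    have h1 := (exists_shift htot a x).choose_spec
    have h2 := (exists_shift htot (ortho a) (exists_shift htot a x).choose).choose_spec
    have e := congrArg (fun z : ℤ × {t : T // t ≠ 1} => (z.1 - 1, z.2))
      (h2.unique (shift_ortho_iff.2 h1))
    simpa using e
  right_inv y := by
    have h1 := (exists_shift htot (ortho a) y).choose_spec
    refine (exists_shift htot a _).choose_spec.unique (shift_ortho_iff.1 ?_)
    rwa [sub_add_cancel]

theorem shift_translation (htot : ∀ a b : T, Le a b ∨ Le b a) (a : T)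
    (x : ℤ × {t : T // t ≠ 1}) : Shift a x (translation htot a x) :=
  (exists_shift htot a x).choose_spec

theorem translation_mul (htot : ∀ a b : T, Le a b ∨ Le b a) {a b c : T}
    (h : oplus a b = some c) :
    translation htot a * translation htot b = translation htot c := by
  rw [oplus_comm] at h
  ext1 x
  exact ((shift_translation htot b x).comp h (shift_translation htot a _)).unique
    (shift_translation htot c x)

/-- If `a ⊕ b` is undefined, then `a = b' ⊕ d` and `b = d ⊕ a'` for some `d`, and both products
equal the translation by `1` times the translation by `d`. -/
theorem translation_comm (htot : ∀ a b : T, Le a b ∨ Le b a) (a b : T) :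
    translation htot a * translation htot b = translation htot b * translation htot a := by
  rcases htot a (ortho b) with h | ⟨d, hd⟩
  · obtain ⟨c, hc⟩ := exists_oplus_of_le_ortho h
    rw [translation_mul htot hc, translation_mul htot (by rw [oplus_comm, hc])]
  · obtain ⟨f, hf, hf'⟩ := oplus_ortho_cancel hd
    rw [hf', ortho_ortho, oplus_comm] at hf
    calc translation htot a * translation htot b
        = translation htot 1 * translation htot d := by
          rw [← translation_mul htot hf, ← mul_assoc, translation_mul htot (oplus_ortho a)]
      _ = translation htot b * translation htot a := by
          rw [← translation_mul htot hd, ← mul_assoc, translation_mul htot (oplus_ortho b)]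

open UniversalGroup in
/-- In the universal group of a totally ordered effect algebra, sums of images vanish only
trivially. -/
theorem eq_zero_of_of_add_eq_zero_of_total (htot : ∀ a b : T, Le a b ∨ Le b a) {a : T}
    {x : UniversalGroup T} (hx : x ∈ cone T) (h : of a + x = 0) : a = 0 := by
  by_cases h01 : (0 : T) = 1
  · exact ((le_one a).trans (h01 ▸ Le.refl (0 : T))).antisymm (zero_le a)
  have hcomm : ∀ x ∈ Set.range (translation htot), ∀ y ∈ Set.range (translation htot),
      x * y = y * x := by
    rintro _ ⟨a, rfl⟩ _ ⟨b, rfl⟩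
    exact translation_comm htot a b
  -- The universal property needs an abelian target, so the group generated by the translations
  -- replaces the full permutation group.
  have := Subgroup.isMulCommutative_closure hcomm
  let : CommGroup (Subgroup.closure (Set.range (translation htot))) :=
    { (inferInstance : Group (Subgroup.closure (Set.range (translation htot)))) with
      mul_comm := mul_comm' }
  let φ : UniversalGroup T →+ Additive (Subgroup.closure (Set.range (translation htot))) :=
    lift (fun a => Additive.ofMul ⟨translation htot a, Subgroup.subset_closure ⟨a, rfl⟩⟩)
      (fun a b c h => by
        rw [← ofMul_mul]
        exact congrArg Additive.ofMul (Subtype.ext (translation_mul htot h).symm))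
  let act : UniversalGroup T → Equiv.Perm (ℤ × {t : T // t ≠ 1}) := fun x =>
    ((φ x).toMul : Equiv.Perm (ℤ × {t : T // t ≠ 1}))
  have act_of : ∀ a, act (of a) = translation htot a := fun a => by
    simp only [act, φ, lift_of, toMul_ofMul]
  have act_add : ∀ x y, act (x + y) = act x * act y := fun x y => by
    simp only [act, map_add, toMul_add]
    rfl
  have act_zero : act 0 = 1 := by
    simp only [act, map_zero, toMul_zero]
    rfl
  have expand : ∀ a y, y.1 ≤ (translation htot a y).1 := fun a y => by
    rcases shift_translation htot a y with ⟨h, -⟩ | ⟨h, -⟩ <;> omega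
  have expand' : ∀ y, y.1 ≤ (act x y).1 := by
    clear h
    unfold cone at hx
    induction hx using AddSubmonoid.closure_induction with
    | mem x hx =>
      obtain ⟨b, rfl⟩ := hx
      rw [act_of]
      exact expand b
    | zero => simp [act_zero]
    | add x z hx' hz' hx hz =>
      intro y
      rw [act_add, Equiv.Perm.mul_apply]
      exact (hz y).trans (hx _)
  have h1 := congrArg (fun g => act g (0, ⟨0, h01⟩)) h
  simp only [act_add, act_zero, act_of, Equiv.Perm.mul_apply, Equiv.Perm.one_apply] at h1
  have h2 := expand' (0, ⟨0, h01⟩)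
  -- The element `x` moves the origin to a level at least `0`, and `a` must bring it back. A carry
  -- would end at a positive level, so there is none, and a sum equal to `0` has zero summands.
  rcases shift_translation htot a (act x (0, ⟨0, h01⟩)) with ⟨-, h3⟩ | ⟨h3, -⟩
  · rw [h1, oplus_comm] at h3
    exact eq_zero_of_oplus_eq_zero h3
  · rw [h1] at h3
    simp only at h2 h3
    omega

end Chain

end EffectAlgebra

/-! ### Stalks at maximal filters, and strictness of the cone under comparability. -/

namespace EffectAlgebra

open Filter

/-- A family of commuting central compressions of an effect algebra, closed under composition. -/
structure CentralFamily (A : Type*) [EffectAlgebra A] (ι : Type*) where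
  U : ι → A → A
  compl : ι → ι
  top : ι
  additive : ∀ i, IsAdditive (U i)
  eq_self : ∀ i a, Le a (U i 1) → U i a = a
  comp : ∀ i j, ∃ k, ∀ a, U k a = U i (U j a)
  comm : ∀ i j a, U i (U j a) = U j (U i a)
  split : ∀ i a, oplus (U i a) (U (compl i) a) = some a
  top_apply : ∀ a, U top a = a

namespace CentralFamily

variable {A ι : Type*} [EffectAlgebra A] (D : CentralFamily A ι)

theorem idem (i : ι) (a : A) : D.U i (D.U i a) = D.U i a :=
  D.eq_self i _ ((D.additive i).mono (le_one a))

/-- A filter of indices, maximal with the property that no compression in it annihilates `a`. -/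
theorem exists_maximal {a : A} (ha : a ≠ 0) :
    ∃ F : Set ι, D.top ∈ F ∧ (∀ i ∈ F, ∀ j ∈ F, ∃ k ∈ F, ∀ x, D.U k x = D.U i (D.U j x)) ∧
      (∀ i ∈ F, D.U i a ≠ 0) ∧ ∀ i, i ∈ F ∨ D.compl i ∈ F := by
  let S : Set (Set ι) := {F | D.top ∈ F ∧
    (∀ i ∈ F, ∀ j ∈ F, ∃ k ∈ F, ∀ x, D.U k x = D.U i (D.U j x)) ∧ ∀ i ∈ F, D.U i a ≠ 0}
  obtain ⟨F, -, hF⟩ := zorn_subset_nonempty S (by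
    intro c hc hchain hne
    refine ⟨⋃₀ c, ⟨?_, ?_, ?_⟩, fun s hs => Set.subset_sUnion_of_mem hs⟩
    · obtain ⟨s, hs⟩ := hne
      exact ⟨s, hs, (hc hs).1⟩
    · rintro i ⟨s, hs, hi⟩ j ⟨t, ht, hj⟩
      rcases hchain.total hs ht with h | h
      · obtain ⟨k, hk, hk'⟩ := (hc ht).2.1 i (h hi) j hj
        exact ⟨k, ⟨t, ht, hk⟩, hk'⟩
      · obtain ⟨k, hk, hk'⟩ := (hc hs).2.1 i hi j (h hj)
        exact ⟨k, ⟨s, hs, hk⟩, hk'⟩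
    · rintro i ⟨s, hs, hi⟩
      exact (hc hs).2.2 i hi) {D.top} ⟨rfl, by
        rintro i rfl j rfl
        exact ⟨D.top, rfl, fun x => by rw [D.top_apply (D.U D.top x)]⟩, by
        rintro i rfl
        rwa [D.top_apply]⟩
  obtain ⟨h1, h2, h3⟩ := hF.prop
  have key : ∀ i, i ∉ F → ∃ j ∈ F, D.U i (D.U j a) = 0 := by
    intro i hi
    by_contra! hne
    -- The enlarged set consists of the indices that agree with a member of `F` after applying `U
    -- i`. It contains `F` and `i`, and under `hne` none of its members annihilates `a`.
    refine hi (hF.le_of_ge (y := {k | ∃ j ∈ F, ∀ x, D.U i (D.U k x) = D.U i (D.U j x)})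
      ⟨⟨_, h1, fun x => rfl⟩, ?_, ?_⟩ (fun j hj => ⟨j, hj, fun x => rfl⟩)
      ⟨_, h1, fun x => by rw [D.idem, D.top_apply]⟩)
    · rintro k ⟨j, hj, hk⟩ k' ⟨j', hj', hk'⟩
      obtain ⟨m, hm⟩ := D.comp k k'
      obtain ⟨n, hn, hn'⟩ := h2 j hj j' hj'
      refine ⟨m, ⟨n, hn, fun x => ?_⟩, hm⟩
      rw [hm, hk, D.comm, hk', hn', D.comm]
    · rintro k ⟨j, hj, hk⟩ h0
      apply hne j hj
      rw [← hk, h0, (D.additive i).map_zero]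
  refine ⟨F, h1, h2, h3, fun i => ?_⟩
  by_contra! h
  obtain ⟨j, hj, hj'⟩ := key i h.1
  obtain ⟨k, hk, hk'⟩ := key _ h.2
  obtain ⟨m, hm, hm'⟩ := h2 j hj k hk
  apply h3 m hm
  -- With `U m = U j ∘ U k`, both components of `U m a` vanish, one through `j` and the other
  -- through `k`; hence `U m a = 0`, although `m ∈ F`.
  have h4 := D.split i (D.U m a)
  rw [hm', D.comm j k, D.comm _ k, D.comm k j, D.comm (D.compl i) j, hj', hk',
    (D.additive _).map_zero, (D.additive _).map_zero, oplus_zero, Option.some.injEq] at h4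
  rw [hm', ← h4]

/-- A filter of indices along which the compressions are eventually decreasing. -/
def IsDecreasing (l : Filter ι) : Prop :=
  ∀ᶠ i in l, ∀ᶠ j in l, ∀ x, D.U j (D.U i x) = D.U j x

theorem exists_filter {a : A} (ha : a ≠ 0) : ∃ l : Filter ι, D.IsDecreasing l ∧
    (∀ i, (∀ᶠ j in l, ∀ x, D.U j (D.U i x) = D.U j x) ∨
      ∀ᶠ j in l, ∀ x, D.U j (D.U (D.compl i) x) = D.U j x) ∧ ¬ ∀ᶠ j in l, D.U j a = 0 := by
  obtain ⟨F, h1, h2, h3, h4⟩ := D.exists_maximal ha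
  let l : Filter ι :=
    { sets := {s | ∃ i ∈ F, ∀ j ∈ F, (∀ x, D.U j (D.U i x) = D.U j x) → j ∈ s}
      univ_sets := ⟨D.top, h1, fun _ _ _ => trivial⟩
      sets_of_superset := by
        rintro s t ⟨i, hi, h⟩ hst
        exact ⟨i, hi, fun j hj hx => hst (h j hj hx)⟩
      inter_sets := by
        rintro s t ⟨i, hi, h⟩ ⟨j, hj, h'⟩
        obtain ⟨k, hk, hk'⟩ := h2 i hi j hj
        refine ⟨k, hk, fun m hm hx => ⟨h m hm fun x => ?_, h' m hm fun x => ?_⟩⟩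
        · rw [← hx, hk', D.comm j i, D.idem, ← hk', hx]
        · rw [← hx, hk', D.idem, ← hk', hx] }
  have hl : ∀ i ∈ F, ∀ᶠ j in l, ∀ x, D.U j (D.U i x) = D.U j x :=
    fun i hi => ⟨i, hi, fun j _ h => h⟩
  refine ⟨l, ⟨D.top, h1, fun j hj _ => hl j hj⟩, fun i => (h4 i).imp (hl i) (hl _), ?_⟩
  rintro ⟨i, hi, h⟩
  exact h3 i hi (h i hi (D.idem i))

variable {l : Filter ι} (hl : D.IsDecreasing l)

/-- Eventual equality along a filter of indices. -/
def stalkSetoid (l : Filter ι) : Setoid A where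
  r x y := ∀ᶠ i in l, D.U i x = D.U i y
  iseqv :=
    { refl := fun _ => Eventually.of_forall fun _ => rfl
      symm := fun h => h.mono fun _ h => h.symm
      trans := fun h h' => (h.and h').mono fun _ h => h.1.trans h.2 }

/-- The stalk of `A` at a filter of indices. -/
def Stalk (_ : D.IsDecreasing l) : Type _ := Quotient (D.stalkSetoid l)

/-- The germ of an element. -/
def germ (x : A) : D.Stalk hl := Quotient.mk (D.stalkSetoid l) x

variable {hl}

theorem germ_eq {x y : A} : D.germ hl x = D.germ hl y ↔ ∀ᶠ i in l, D.U i x = D.U i y :=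
  Quotient.eq (r := D.stalkSetoid l)

theorem exists_germ_eq (X : D.Stalk hl) : ∃ x, D.germ hl x = X := Quotient.exists_rep X

/-- `z` is eventually the orthosum of `x` and `y`. -/
def StalkSum (l : Filter ι) (x y z : A) : Prop :=
  ∀ᶠ i in l, oplus (D.U i x) (D.U i y) = some (D.U i z)

open Classical in
/-- The partial sum of germs. -/
noncomputable def stalkOplus (X Y : D.Stalk hl) : Option (D.Stalk hl) :=
  if h : ∃ z x y, D.germ hl x = X ∧ D.germ hl y = Y ∧ D.StalkSum l x y z then
    some (D.germ hl h.choose) else none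

theorem stalkOplus_germ {x y z : A} :
    D.stalkOplus (D.germ hl x) (D.germ hl y) = some (D.germ hl z) ↔ D.StalkSum l x y z := by
  constructor
  · intro h
    unfold stalkOplus at h
    split at h
    · next h' =>
      obtain ⟨x', y', hx, hy, hz⟩ := h'.choose_spec
      have hz' := D.germ_eq.1 (Option.some.inj h)
      filter_upwards [D.germ_eq.1 hx, D.germ_eq.1 hy, hz, hz'] with i h1 h2 h3 h4
      rw [← h1, ← h2, h3, h4]
    · cases h
  · intro h
    have h' : ∃ z' x' y', D.germ hl x' = D.germ hl x ∧ D.germ hl y' = D.germ hl y ∧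
      D.StalkSum l x' y' z' := ⟨z, x, y, rfl, rfl, h⟩
    unfold stalkOplus
    rw [dif_pos h', Option.some.injEq, germ_eq]
    obtain ⟨x', y', hx, hy, hz⟩ := h'.choose_spec
    filter_upwards [D.germ_eq.1 hx, D.germ_eq.1 hy, hz, h] with i h1 h2 h3 h4
    rw [h1, h2, h4] at h3
    exact (Option.some.inj h3).symm

/-- The witnesses `z` may vary with the index, but one taken at a single index `i` works for all
later `j`, because `U j` factors through `U i`. -/
theorem exists_stalkSum [l.NeBot] (hl : D.IsDecreasing l) {x y : A}
    (h : ∀ᶠ i in l, ∃ z, oplus (D.U i x) z = some (D.U i y)) : ∃ z, D.StalkSum l x z y := by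
  obtain ⟨i, ⟨z, hz⟩, hi⟩ := (h.and hl).exists
  refine ⟨z, ?_⟩
  filter_upwards [hi] with j hj
  have := D.additive j _ _ _ hz
  rwa [hj, hj] at this

/-- The stalks are effect algebras. -/
noncomputable instance [l.NeBot] : EffectAlgebra (D.Stalk hl) where
  zero := D.germ hl 0
  one := D.germ hl 1
  oplus := D.stalkOplus
  ortho := Quotient.map ortho fun x y (h : ∀ᶠ i in l, D.U i x = D.U i y) => h.mono fun i h => by
    have h1 := D.additive i _ _ _ (oplus_ortho x)
    have h2 := D.additive i _ _ _ (oplus_ortho y)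
    rw [h] at h1
    exact oplus_left_cancel h1 h2
  oplus_comm X Y := by
    obtain ⟨x, rfl⟩ := D.exists_germ_eq X
    obtain ⟨y, rfl⟩ := D.exists_germ_eq Y
    ext Z
    obtain ⟨z, rfl⟩ := D.exists_germ_eq Z
    simp only [stalkOplus_germ, StalkSum, oplus_comm]
  oplus_assoc X Y Z V W h h' := by
    obtain ⟨x, rfl⟩ := D.exists_germ_eq X
    obtain ⟨y, rfl⟩ := D.exists_germ_eq Y
    obtain ⟨z, rfl⟩ := D.exists_germ_eq Z
    obtain ⟨v, rfl⟩ := D.exists_germ_eq V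
    obtain ⟨w, rfl⟩ := D.exists_germ_eq W
    rw [stalkOplus_germ] at h h'
    obtain ⟨f, hf⟩ := D.exists_stalkSum hl (x := x) (y := w) (by
      filter_upwards [h, h'] with i h1 h2
      obtain ⟨f, -, hf⟩ := oplus_assoc _ _ _ _ _ h1 h2
      exact ⟨f, hf⟩)
    refine ⟨D.germ hl f, D.stalkOplus_germ.2 ?_, D.stalkOplus_germ.2 hf⟩
    filter_upwards [h, h', hf] with i h1 h2 h3
    obtain ⟨g, hg, hg'⟩ := oplus_assoc _ _ _ _ _ h1 h2
    rwa [← oplus_left_cancel hg' h3]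
  oplus_ortho X := by
    obtain ⟨x, rfl⟩ := D.exists_germ_eq X
    exact D.stalkOplus_germ.2 (Eventually.of_forall fun i => D.additive i _ _ _ (oplus_ortho x))
  eq_ortho X Y h := by
    obtain ⟨x, rfl⟩ := D.exists_germ_eq X
    obtain ⟨y, rfl⟩ := D.exists_germ_eq Y
    have h' : D.StalkSum l x y 1 := D.stalkOplus_germ.1 h
    refine D.germ_eq.2 (h'.mono fun i h => ?_)
    exact oplus_left_cancel h (D.additive i _ _ _ (oplus_ortho x))
  eq_zero_of_oplus_one X Y h := by
    obtain ⟨x, rfl⟩ := D.exists_germ_eq X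
    obtain ⟨y, rfl⟩ := D.exists_germ_eq Y
    have h' : D.StalkSum l x 1 y := D.stalkOplus_germ.1 h
    refine D.germ_eq.2 (h'.mono fun i h => ?_)
    have h1 := ((D.additive i).mono (le_one y)).antisymm (le_right h)
    rw [oplus_comm, h1] at h
    rw [eq_zero_of_oplus_eq_self h, (D.additive i).map_zero]

theorem germ_isAdditive [l.NeBot] : IsAdditive (D.germ hl) := fun _ _ _ h =>
  D.stalkOplus_germ.2 (Eventually.of_forall fun i => D.additive i _ _ _ h)

theorem germ_le [l.NeBot] {x y : A} (h : ∀ᶠ i in l, Le (D.U i x) (D.U i y)) :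
    Le (D.germ hl x) (D.germ hl y) := by
  obtain ⟨z, hz⟩ := D.exists_stalkSum hl h
  exact ⟨D.germ hl z, D.stalkOplus_germ.2 hz⟩

end CentralFamily

open UniversalGroup in
/-- In the universal group of an effect algebra with comparability, sums of images vanish only
trivially. -/
theorem CentralFamily.eq_zero_of_of_add_eq_zero {A : Type u} {ι : Type*} [EffectAlgebra A]
    (D : CentralFamily A ι)
    (hcomp : ∀ a b, ∃ i, Le (D.U i a) (D.U i b) ∧ Le (D.U (D.compl i) b) (D.U (D.compl i) a))
    {a : A} {x : UniversalGroup A} (hx : x ∈ cone A) (h : of a + x = 0) : a = 0 := by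
  by_contra ha
  obtain ⟨l, hl, hultra, hal⟩ := D.exists_filter ha
  have : l.NeBot := ⟨by
    rintro rfl
    exact hal trivial⟩
  -- Comparability gives one inequality on `i` and the reverse one on its complement, and the filter
  -- eventually lies below one of the two.
  have htot : ∀ X Y : D.Stalk hl, Le X Y ∨ Le Y X := by
    intro X Y
    obtain ⟨x, rfl⟩ := D.exists_germ_eq X
    obtain ⟨y, rfl⟩ := D.exists_germ_eq Y
    obtain ⟨i, h1, h2⟩ := hcomp x y
    refine (hultra i).imp (fun h => D.germ_le ?_) (fun h => D.germ_le ?_)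
    · filter_upwards [h] with j hj
      have := (D.additive j).mono h1
      rwa [hj, hj] at this
    · filter_upwards [h] with j hj
      have := (D.additive j).mono h2
      rwa [hj, hj] at this
  have h1 := congrArg (map (D.germ hl) D.germ_isAdditive) h
  rw [map_add, map_of, _root_.map_zero] at h1
  have h2 := D.germ_eq.1 (eq_zero_of_of_add_eq_zero_of_total htot (map_mem_cone _ hx) h1)
  exact hal (h2.mono fun i h => h.trans (D.additive i).map_zero)

end EffectAlgebra

/-! ### The universal group of a C-block and its spectral projections. -/

namespace EffectAlgebra.UniversalGroup

variable {A : Type*} [EffectAlgebra A]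

theorem induction_on {motive : UniversalGroup A → Prop} (g : UniversalGroup A)
    (of : ∀ a, motive (of a)) (zero : motive 0) (neg : ∀ g, motive g → motive (-g))
    (add : ∀ g h, motive g → motive h → motive (g + h)) : motive g := by
  obtain ⟨x, rfl⟩ := QuotientAddGroup.mk_surjective g
  induction x using FreeAbelianGroup.induction_on with
  | zero => exact zero
  | of a => exact of a
  | neg a h => exact neg _ h
  | add x y hx hy => exact add _ _ hx hy

theorem hom_ext {H : Type*} [AddCommGroup H] {f f' : UniversalGroup A →+ H}
    (h : ∀ a, f (of a) = f' (of a)) : f = f' := by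
  refine DFunLike.ext _ _ fun g => ?_
  induction g using induction_on with
  | of a => exact h a
  | zero => rw [map_zero, map_zero]
  | neg g h => rw [map_neg, map_neg, h]
  | add g g' h h' => rw [map_add, map_add, h, h']

end EffectAlgebra.UniversalGroup

namespace CompressionBase

open EffectAlgebra UniversalGroup

variable {E : Type u} [EffectAlgebra E] {K : CompressionBase E}

theorem J_proj_comm {p q : E} (hp : p ∈ K.P.carrier) (hq : q ∈ K.P.carrier) (h : Compat p q) :
    K.J p q = K.J q p := by
  have := J_comm hp hq h 1
  rwa [K.focus p hp, K.focus q hq] at this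

theorem le_of_J_ortho_eq_zero {p q : E} (hp : p ∈ K.P.carrier) (h : K.J p (ortho q) = 0) :
    Le p q := by
  have := (le_ortho_of_J_eq_zero hp h).ortho
  rwa [ortho_ortho, ortho_ortho] at this

theorem eq_zero_of_le_ortho {p : E} (hp : p ∈ K.P.carrier) (h : Le p (ortho p)) : p = 0 := by
  rw [← J_eq_self hp (Le.refl p)]
  exact J_eq_zero hp h

namespace Block

variable (B : K.Block)

theorem mem_of_mem_C {p : E} (hp : p ∈ K.P.carrier) (h : ∀ q ∈ B.carrier, p ∈ K.C q) :
    p ∈ B.carrier :=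
  B.maximal p hp fun q hq => compat_symm (compat_of_mem_C (B.subset hq) (h q hq))

theorem mem_cblock {p : E} (hp : p ∈ B.carrier) : p ∈ B.cblock.carrier := (B.incl ⟨p, hp⟩).2

theorem one_mem : (1 : E) ∈ B.carrier :=
  B.mem_of_mem_C K.P.one_mem fun _ hq => one_mem_C (B.subset hq)

theorem zero_mem : (0 : E) ∈ B.carrier := ortho_one (E := E) ▸ B.ortho_mem B.one_mem

theorem oplus_mem {p q r : E} (hp : p ∈ B.carrier) (hq : q ∈ B.carrier) (h : oplus p q = some r) :
    r ∈ B.carrier :=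
  B.mem_of_mem_C (K.P.oplus_mem _ (B.subset hp) _ (B.subset hq) _ h)
    (B.cblock.oplus_mem _ (B.mem_cblock hp) _ (B.mem_cblock hq) _ h)

theorem J_mem {p q : E} (hp : p ∈ B.carrier) (hq : q ∈ B.carrier) : K.J p q ∈ B.carrier :=
  B.mem_of_mem_C (J_J_mem (B.subset hp) (B.subset hq) (B.compat p hp q hq)).1
    (B.U ⟨p, hp⟩ (B.incl ⟨q, hq⟩)).2

theorem mem_PC {A : Set E} (hA : A ⊆ B.cblock.carrier) {p : E} (hp : p ∈ B.carrier) :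
    p ∈ K.PC A :=
  ⟨B.subset hp, fun _ ha => hA ha p hp⟩

/-- `B` lies in `PC(A)`, so every projection of the bicommutant is compatible with `B` and belongs
to it by maximality. Comparability in `E` thus yields comparing projections inside the block. -/
theorem bicomm_subset {A : Set E} (hA : A ⊆ B.cblock.carrier) : K.bicomm A ⊆ B.carrier :=
  fun _ hp => B.maximal _ hp.1 fun _ hq => compat_of_mem_bicomm hp (B.mem_PC hA hq)

/-- The compressions of a C-block. -/
def family : CentralFamily B.cblock.carrier B.carrier where
  U := B.U
  compl := B.compl
  top := ⟨1, B.one_mem⟩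
  additive := B.U_additive
  eq_self p a h := Subtype.ext (J_eq_self (B.subset p.2) (by
    have h1 := (B.cblock.le_iff).1 h
    rwa [show ((B.U p 1 : B.cblock.carrier) : E) = p from K.focus p (B.subset p.2)] at h1))
  comp p q := ⟨⟨K.J p q, B.J_mem p.2 q.2⟩, fun a => Subtype.ext
    ((J_J_mem (B.subset p.2) (B.subset q.2) (B.compat p p.2 q q.2)).2 a).symm⟩
  comm p q a := Subtype.ext (J_comm (B.subset p.2) (B.subset q.2) (B.compat p p.2 q q.2) a)
  split p a := (subOplus_eq B.cblock _ _ _).2 (a.2 p p.2)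
  top_apply a := Subtype.ext (J_eq_self K.P.one_mem (le_one (a : E)))

theorem comparability (hK : K.BComparability) (a b : B.cblock.carrier) :
    ∃ p, Le (B.U p a) (B.U p b) ∧ Le (B.U (B.compl p) b) (B.U (B.compl p) a) := by
  have ha : {(a : E)} ⊆ B.cblock.carrier := Set.singleton_subset_iff.2 a.2
  have hb : {(b : E)} ⊆ B.cblock.carrier := Set.singleton_subset_iff.2 b.2
  obtain ⟨p, hp, h1, h2⟩ := hK.2 a b fun p hp q hq =>
    B.compat p (B.bicomm_subset ha hp) q (B.bicomm_subset hb hq)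
  have hpB := B.bicomm_subset (Set.insert_subset a.2 hb) hp
  exact ⟨⟨p, hpB⟩, B.cblock.le_iff.2 h1, B.cblock.le_iff.2 h2⟩

/-- Strictness of the cone: the case of a generator comes from the stalks, and sums of generators
follow by moving the other summands into `y`. -/
theorem eq_zero_of_add_eq_zero (hK : K.BComparability) {x y : B.G} (hx : x ∈ cone B.cblock.carrier)
    (hy : y ∈ cone B.cblock.carrier) (h : x + y = 0) : x = 0 := by
  unfold cone at hx
  induction hx using AddSubmonoid.closure_induction generalizing y with
  | mem x hx =>
    obtain ⟨a, rfl⟩ := hx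
    rw [B.family.eq_zero_of_of_add_eq_zero (B.comparability hK) hy h, of_zero]
  | zero => rfl
  | add x z hx hz ihx ihz =>
    rw [ihx (add_mem hz hy) (by rw [← h, add_assoc]),
      ihz (add_mem hx hy) (by rw [← h]; abel), add_zero]

theorem eq_zero_of_nsmul_eq_zero (hK : K.BComparability) {x : B.G}
    (hx : x ∈ cone B.cblock.carrier) {t : ℕ} (ht : 0 < t) (h : t • x = 0) : x = 0 := by
  obtain ⟨s, rfl⟩ := Nat.exists_eq_succ_of_ne_zero ht.ne'
  rw [succ_nsmul'] at h
  exact B.eq_zero_of_add_eq_zero hK hx (nsmul_mem hx s) h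

open Classical in
/-- The image in the universal group of an element of the C-block. -/
noncomputable def toG (x : E) : B.G := if h : x ∈ B.cblock.carrier then of ⟨x, h⟩ else 0

open Classical in
/-- The extension of `J_p` to the universal group, for `p` in the block. -/
noncomputable def ext (p : E) : B.G →+ B.G := if h : p ∈ B.carrier then B.extU ⟨p, h⟩ else 0

variable {B}

theorem toG_eq {x : E} (h : x ∈ B.cblock.carrier) : B.toG x = of ⟨x, h⟩ := dif_pos h

theorem ext_eq {p : E} (h : p ∈ B.carrier) : B.ext p = B.extU ⟨p, h⟩ := dif_pos h

theorem toG_mem_cone (x : E) : B.toG x ∈ cone B.cblock.carrier := by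
  unfold toG
  split
  · exact of_mem_cone _
  · exact AddSubmonoid.zero_mem _

theorem toG_oplus {x y z : E} (hx : x ∈ B.cblock.carrier) (hy : y ∈ B.cblock.carrier)
    (h : oplus x y = some z) : B.toG z = B.toG x + B.toG y := by
  rw [toG_eq hx, toG_eq hy, toG_eq (B.cblock.oplus_mem _ hx _ hy _ h)]
  exact of_oplus ((subOplus_eq B.cblock _ _ _).2 h)

theorem toG_zero : B.toG 0 = 0 := by
  rw [toG_eq B.cblock.zero_mem]
  exact of_zero

theorem eq_zero_of_toG_eq_zero (hK : K.BComparability) {x : E} (hx : x ∈ B.cblock.carrier)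
    (h : B.toG x = 0) : x = 0 := by
  rw [toG_eq hx] at h
  exact congrArg Subtype.val (B.family.eq_zero_of_of_add_eq_zero (B.comparability hK)
    (AddSubmonoid.zero_mem _) (by rw [h, add_zero]))

theorem J_mem_cblock {p x : E} (hp : p ∈ B.carrier) (hx : x ∈ B.cblock.carrier) :
    K.J p x ∈ B.cblock.carrier :=
  (B.U ⟨p, hp⟩ ⟨x, hx⟩).2

theorem ext_toG {p x : E} (hp : p ∈ B.carrier) (hx : x ∈ B.cblock.carrier) :
    B.ext p (B.toG x) = B.toG (K.J p x) := by
  rw [ext_eq hp, toG_eq hx, toG_eq (J_mem_cblock hp hx), extU, map_of]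
  rfl

theorem ext_of {p : E} (hp : p ∈ B.carrier) (x : B.cblock.carrier) :
    B.ext p (of x) = B.toG (K.J p x) := by
  rw [← ext_toG hp x.2, toG_eq x.2]

theorem ext_mem_cone {p : E} (hp : p ∈ B.carrier) {x : B.G} (hx : x ∈ cone B.cblock.carrier) :
    B.ext p x ∈ cone B.cblock.carrier := by
  rw [ext_eq hp]
  exact map_mem_cone _ hx

theorem ext_ext {p q : E} (hp : p ∈ B.carrier) (hq : q ∈ B.carrier) (g : B.G) :
    B.ext p (B.ext q g) = B.ext (K.J p q) g := by
  have h : (B.ext p).comp (B.ext q) = B.ext (K.J p q) := hom_ext fun a => by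
    rw [AddMonoidHom.comp_apply, ext_of hq, ext_toG hp (J_mem_cblock hq a.2),
      ext_of (B.J_mem hp hq),
      (J_J_mem (B.subset hp) (B.subset hq) (B.compat p hp q hq)).2]
  exact DFunLike.congr_fun h g

theorem ext_one (g : B.G) : B.ext 1 g = g := by
  have h : B.ext 1 = AddMonoidHom.id B.G := hom_ext fun a => by
    rw [ext_of B.one_mem, J_eq_self K.P.one_mem (le_one _), toG_eq a.2]
    rfl
  exact DFunLike.congr_fun h g

theorem ext_zero (g : B.G) : B.ext 0 g = 0 := by
  have h : B.ext 0 = 0 := hom_ext fun a => by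
    rw [ext_of B.zero_mem, eq_zero_of_le_zero (J_le (B.subset B.zero_mem) _), toG_zero]
    rfl
  exact DFunLike.congr_fun h g

theorem ext_oplus {p q r : E} (hp : p ∈ B.carrier) (hq : q ∈ B.carrier) (h : oplus p q = some r)
    (g : B.G) : B.ext r g = B.ext p g + B.ext q g := by
  have hr := B.oplus_mem hp hq h
  have hpr := le_left h
  have e : K.J r (ortho p) = q := by
    have h1 := additive (B.subset hr) _ _ _ (oplus_ortho p)
    rw [J_eq_self (B.subset hr) hpr, K.focus r (B.subset hr)] at h1
    exact oplus_left_cancel h1 h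
  have h' : B.ext r = B.ext p + B.ext q := hom_ext fun a => by
    have h1 := additive (B.subset hr) _ _ _ (a.2 p hp)
    have hp' := B.ortho_mem hp
    rw [J_eq_self (B.subset hr) ((J_le (B.subset hp) _).trans hpr),
      (J_J_mem (B.subset hr) (B.subset hp') (B.compat r hr _ hp')).2, e] at h1
    rw [AddMonoidHom.add_apply, ext_of hr, ext_of hp, ext_of hq,
      toG_oplus (J_mem_cblock hp a.2) (J_mem_cblock hq a.2) h1]
  exact DFunLike.congr_fun h' g

theorem ext_add_ext_ortho {p : E} (hp : p ∈ B.carrier) (g : B.G) :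
    B.ext p g + B.ext (ortho p) g = g := by
  rw [← ext_oplus hp (B.ortho_mem hp) (oplus_ortho p), ext_one]

/-- The order of `B` is recovered from `G`: compressing `q - p ≥ 0` by `r = J_p(q')` kills `q` and
turns `p` into `r`, so `-r ≥ 0` and strictness gives `r = 0`. -/
theorem leG_iff (hK : K.BComparability) (p q : B.carrier) :
    LeG (of (B.incl p)) (of (B.incl q)) ↔ Le (p : E) q := by
  have ep : of (B.incl p) = B.toG p := (toG_eq (B.mem_cblock p.2)).symm
  have eq : of (B.incl q) = B.toG q := (toG_eq (B.mem_cblock q.2)).symm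
  rw [ep, eq]
  have hpP := B.subset p.2
  have hqP := B.subset q.2
  have hq' := B.ortho_mem q.2
  constructor
  · intro h
    have hr := B.J_mem p.2 hq'
    have hrP := B.subset hr
    have h1 : Le (K.J p (ortho q)) (ortho q) := by
      rw [J_proj_comm hpP (B.subset hq') (B.compat _ p.2 _ hq')]
      exact J_le (B.subset hq') _
    have h2 := ext_mem_cone hr h
    rw [_root_.map_sub, ext_toG hr (B.mem_cblock q.2), ext_toG hr (B.mem_cblock p.2),
      J_eq_zero hrP (le_ortho_comm h1), toG_zero, zero_sub, J_eq_of_le hrP (J_le hpP _)] at h2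
    exact le_of_J_ortho_eq_zero hpP (eq_zero_of_toG_eq_zero hK (B.mem_cblock hr)
      (B.eq_zero_of_add_eq_zero hK (toG_mem_cone _) h2 (add_neg_cancel _)))
  · rintro ⟨d, hd⟩
    have hdC := B.cblock.of_oplus_mem hd (B.mem_cblock p.2) (B.mem_cblock q.2)
    unfold LeG
    rw [toG_oplus (B.mem_cblock p.2) hdC hd, add_sub_cancel_left]
    exact toG_mem_cone _

/-- `g` is negative on the projection `p`. -/
def NegOn (g : B.G) (p : E) : Prop := p ∈ B.carrier ∧ -B.ext p g ∈ cone B.cblock.carrier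

/-- `g` is positive on the projection `p`, and vanishes on no nonzero part of `p`. -/
def PosOn (g : B.G) (p : E) : Prop :=
  p ∈ B.carrier ∧ B.ext p g ∈ cone B.cblock.carrier ∧
    ∀ q ∈ B.carrier, Le q p → B.ext q g = 0 → q = 0

theorem NegOn.zero (g : B.G) : NegOn g 0 :=
  ⟨B.zero_mem, by rw [ext_zero, neg_zero]; exact AddSubmonoid.zero_mem _⟩

theorem PosOn.zero (g : B.G) : PosOn g 0 :=
  ⟨B.zero_mem, by rw [ext_zero]; exact AddSubmonoid.zero_mem _, fun _ _ h _ => eq_zero_of_le_zero h⟩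

theorem NegOn.oplus {g : B.G} {p q r : E} (h : EffectAlgebra.oplus p q = some r)
    (hp : NegOn g p) (hq : NegOn g q) : NegOn g r := by
  refine ⟨B.oplus_mem hp.1 hq.1 h, ?_⟩
  rw [ext_oplus hp.1 hq.1 h, neg_add]
  exact add_mem hp.2 hq.2

theorem PosOn.oplus (hK : K.BComparability) {g : B.G} {p q r : E}
    (h : EffectAlgebra.oplus p q = some r) (hp : PosOn g p) (hq : PosOn g q) : PosOn g r := by
  have hr := B.oplus_mem hp.1 hq.1 h
  refine ⟨hr, ?_, fun s hs hsr h0 => ?_⟩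
  · rw [ext_oplus hp.1 hq.1 h]
    exact add_mem hp.2.1 hq.2.1
  · have hsP := B.subset hs
    have h1 : B.ext s (B.ext p g) + B.ext s (B.ext q g) = 0 := by
      rw [← map_add, ← ext_oplus hp.1 hq.1 h, ext_ext hs hr, J_eq_of_le hsP hsr, h0]
    have hpc := ext_mem_cone hs hp.2.1
    have hqc := ext_mem_cone hs hq.2.1
    -- Both parts of `U_s(g)` are positive with sum `0`, so each vanishes; then `s` meets neither
    -- `p` nor `q`.
    have part : ∀ p, PosOn g p → B.ext s (B.ext p g) = 0 → K.J s p = 0 := by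
      intro p hp h0
      rw [ext_ext hs hp.1] at h0
      refine hp.2.2 _ (B.J_mem hs hp.1) ?_ h0
      rw [J_proj_comm hsP (B.subset hp.1) (B.compat _ hs _ hp.1)]
      exact J_le (B.subset hp.1) _
    have h2 := additive hsP _ _ _ h
    rw [part p hp (B.eq_zero_of_add_eq_zero hK hpc hqc h1),
      part q hq (B.eq_zero_of_add_eq_zero hK hqc hpc (by rw [add_comm, h1])), oplus_zero,
      J_eq_of_le hsP hsr] at h2
    exact (Option.some.inj h2).symm

/-- The sign decomposition determines everything: `(t g)_+ = t U_{p'}(g)`, and `U_q` annihilates it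
exactly when `q` does not meet `p'`. The factor `t` is harmless since the cone is strict. -/
theorem spectralProjection_eq_some (hK : K.BComparability) {g : B.G} {p : E} (hp : NegOn g p)
    (hp' : PosOn g (ortho p)) {t : ℕ} (ht : 0 < t) {a : B.cblock.carrier} {m : ℤ} {n : ℕ}
    (hg : n • of a - m • of 1 = t • g) : B.spectralProjection a m n = some p := by
  have hsplit := fun k => ext_add_ext_ortho hp.1 k
  have hneg : t • B.ext (ortho p) g - t • g ∈ cone B.cblock.carrier := by
    have : t • B.ext (ortho p) g - t • g = t • (-B.ext p g) := by
      rw [← smul_sub]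
      congr 1
      calc B.ext (ortho p) g - g = B.ext (ortho p) g - (B.ext p g + B.ext (ortho p) g) := by
            rw [hsplit]
        _ = -B.ext p g := by abel
    rw [this]
    exact nsmul_mem hp.2 t
  have hpos : UniversalGroup.pos (t • g) = some (t • B.ext (ortho p) g) := by
    have hle : LeG (t • g) (t • B.ext (ortho p) g) ∧ LeG 0 (t • B.ext (ortho p) g) ∧
        ∀ k, LeG (t • g) k → LeG 0 k → LeG (t • B.ext (ortho p) g) k := by
      refine ⟨hneg, ?_, fun k h1 h2 => ?_⟩
      · unfold LeG
        rw [sub_zero]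
        exact nsmul_mem hp'.2.1 t
      · unfold LeG at h1 h2 ⊢
        rw [sub_zero] at h2
        -- Compressing `k ≥ 0` by `p` and `k - t g ≥ 0` by `p'` and adding gives `k - t U_{p'}(g) ≥
        -- 0`.
        have h3 := add_mem (ext_mem_cone hp.1 h2) (ext_mem_cone hp'.1 h1)
        rwa [_root_.map_sub, map_nsmul, ← add_sub_assoc, hsplit] at h3
    refine theUnique_eq_some hle fun y hy => ?_
    have h1 := hle.2.2 y hy.1 hy.2.1
    have h2 := hy.2.2 _ hle.1 hle.2.1
    exact sub_eq_zero.1 (B.eq_zero_of_add_eq_zero hK h1 h2 (by abel))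
  have hric : B.rickart (t • B.ext (ortho p) g) = some ⟨p, hp.1⟩ := by
    have h : ∀ q : B.carrier, LeG (of (B.incl q)) (of (B.incl ⟨p, hp.1⟩)) ↔
        t • B.ext (ortho p) g = B.extU q (t • B.ext (ortho p) g) +
          B.extU (B.compl q) (t • B.ext (ortho p) g) ∧
        B.extU q (t • B.ext (ortho p) g) = 0 := by
      rintro ⟨q, hq⟩
      have hqP := B.subset hq
      have e1 : B.extU ⟨q, hq⟩ = B.ext q := (ext_eq hq).symm
      have e2 : B.extU (B.compl ⟨q, hq⟩) = B.ext (ortho q) := (ext_eq (B.ortho_mem hq)).symm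
      -- Every element of `G` commutes with every `q ∈ B`, so only the vanishing condition remains.
      rw [leG_iff hK, e1, e2, ext_add_ext_ortho hq, and_iff_right rfl, map_nsmul]
      constructor
      · intro h
        rw [ext_ext hq hp'.1, J_eq_zero hqP (Le.ortho h), ext_zero, smul_zero]
      · intro h
        have h1 := B.eq_zero_of_nsmul_eq_zero hK (ext_mem_cone hq hp'.2.1) ht h
        rw [ext_ext hq hp'.1] at h1
        refine le_of_J_ortho_eq_zero hqP (hp'.2.2 _ (B.J_mem hq hp'.1) ?_ h1)
        rw [J_proj_comm hqP (B.subset hp'.1) (B.compat _ hq _ hp'.1)]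
        exact J_le (B.subset hp'.1) _
    refine theUnique_eq_some h fun r hr => Subtype.ext ?_
    have h1 := (h r).2 ((hr r).1 ((leG_iff hK r r).2 (Le.refl _)))
    have h2 := (hr ⟨p, hp.1⟩).2 ((h _).1 ((leG_iff hK _ _).2 (Le.refl _)))
    exact ((leG_iff hK _ _).1 h1).antisymm ((leG_iff hK _ _).1 h2)
  unfold spectralProjection
  rw [hg, hpos]
  simp [hric]

end Block

end CompressionBase

/-! ### Signs of `2 ^ N a - k u` on the pieces, and the theorem. -/

namespace CompressionBase

open EffectAlgebra UniversalGroup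

variable {E : Type u} [EffectAlgebra E] {K : CompressionBase E}

namespace IsSplitting

variable {a : E} {c u : List Bool → E} {B : K.Block}

theorem isCover_nil (h : K.IsSplitting a c u) : K.IsCover a (u []) := by
  have := h.isCover []
  rwa [h.c_nil] at this

theorem c_mem (h : K.IsSplitting a c u) (ha : a ∈ B.cblock.carrier)
    (w : List Bool) : c w ∈ B.cblock.carrier := fun q hq =>
  h.mem_C w q (B.mem_PC (Set.singleton_subset_iff.2 ha) hq)

theorem u_mem (h : K.IsSplitting a c u) (ha : a ∈ B.cblock.carrier)
    (hK : K.CoverProperty) (w : List Bool) : u w ∈ B.carrier :=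
  B.mem_of_mem_C (h.u_mem_P w) fun q hq =>
    (h.isCover w).mem_C hK (B.subset hq) (h.c_mem ha w q hq)

/-- On `u_w`, the element `2ⁿ a` is the sum of an integer multiple of `u_w` and of `c_w`. -/
theorem two_pow_nsmul (h : K.IsSplitting a c u) (ha : a ∈ B.cblock.carrier)
    (hK : K.CoverProperty) (w : List Bool) :
    2 ^ w.length • B.ext (u w) (B.toG a) = wordValue w • B.toG (u w) + B.toG (c w) := by
  have huB := h.u_mem ha hK
  induction w using List.reverseRecOn with
  | nil =>
    rw [Block.ext_toG (huB _) ha, J_eq_self (B.subset (huB _)) h.isCover_nil.le, h.c_nil]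
    simp [wordValue]
  | append_singleton w b ih =>
    have hle : Le (u (w ++ [b])) (u w) := by
      cases b
      · exact le_left (h.oplus_u w)
      · exact le_right (h.oplus_u w)
    have hbP := B.subset (huB (w ++ [b]))
    have h1 := congrArg (B.ext (u (w ++ [b]))) ih
    rw [map_nsmul, map_add, map_nsmul, Block.ext_ext (huB _) (huB _), J_eq_of_le hbP hle,
      Block.ext_toG (huB _) (B.mem_cblock (huB _)), J_eq_of_le hbP hle,
      Block.ext_toG (huB _) (h.c_mem ha w)] at h1
    have hJ := Block.J_mem_cblock (huB (w ++ [b])) (h.c_mem ha w)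
    have h2 : 2 • B.toG (K.J (u (w ++ [b])) (c w)) =
        b.toNat • B.toG (u (w ++ [b])) + B.toG (c (w ++ [b])) := by
      cases b with
      | false => rw [Block.toG_oplus hJ hJ (h.c_false w), Bool.toNat_false, zero_smul, zero_add,
          two_nsmul]
      | true =>
        obtain ⟨d, hd, hd'⟩ := h.c_true w
        have hcC := h.c_mem ha (w ++ [true])
        have hdC := B.cblock.of_oplus_mem hd hcC hJ
        rw [Block.toG_oplus hdC hJ hd', Bool.toNat_true, one_smul]
        -- Only one of the two copies is expanded as `c_{w1} + d`; this `d` and the other copy make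
        -- up `u_{w1}`.
        conv_lhs => rw [two_nsmul]
        conv_lhs => enter [2]; rw [Block.toG_oplus hcC hdC hd]
        abel
    rw [List.length_append, List.length_singleton, pow_succ', mul_smul, h1, wordValue_append,
      smul_add, h2, add_smul, mul_smul, add_assoc]

theorem ext_u (h : K.IsSplitting a c u) (ha : a ∈ B.cblock.carrier)
    (hK : K.CoverProperty) (w : List Bool) (k : ℕ) :
    B.ext (u w) (2 ^ w.length • B.toG a - k • B.toG 1) =
      wordValue w • B.toG (u w) + B.toG (c w) - k • B.toG (u w) := by
  have huB := h.u_mem ha hK w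
  rw [_root_.map_sub, map_nsmul, map_nsmul, h.two_pow_nsmul ha hK,
    Block.ext_toG huB B.cblock.one_mem, K.focus _ (B.subset huB)]

theorem negOn (h : K.IsSplitting a c u) (ha : a ∈ B.cblock.carrier)
    (hK : K.CoverProperty) {w : List Bool} {k : ℕ} (hk : wordValue w + 1 ≤ k) :
    Block.NegOn (2 ^ w.length • B.toG a - k • B.toG 1) (u w) := by
  refine ⟨h.u_mem ha hK w, ?_⟩
  obtain ⟨j, rfl⟩ := Nat.exists_eq_add_of_le hk
  obtain ⟨d, hd⟩ := (h.isCover w).le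
  have hcC := h.c_mem ha w
  have hdC := B.cblock.of_oplus_mem hd hcC (B.mem_cblock (h.u_mem ha hK w))
  -- The unit to spare in `k` absorbs `c_w`, leaving the remainder `d = u_w ⊖ c_w`.
  have e : -(wordValue w • B.toG (u w) + B.toG (c w) - (wordValue w + 1 + j) • B.toG (u w)) =
      B.toG d + j • B.toG (u w) := by
    rw [add_smul, add_smul, one_smul]
    conv_lhs => enter [1, 2, 1, 2]; rw [Block.toG_oplus hcC hdC hd]
    abel
  rw [h.ext_u ha hK, e]
  exact add_mem (Block.toG_mem_cone _) (nsmul_mem (Block.toG_mem_cone _) j)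

theorem posOn (h : K.IsSplitting a c u) (ha : a ∈ B.cblock.carrier)
    (hK : K.Spectral) {w : List Bool} {k : ℕ} (hk : k ≤ wordValue w) :
    Block.PosOn (2 ^ w.length • B.toG a - k • B.toG 1) (u w) := by
  have huB := h.u_mem ha hK.2 w
  have hcC := h.c_mem ha w
  obtain ⟨j, hj⟩ := Nat.exists_eq_add_of_le hk
  have e : B.ext (u w) (2 ^ w.length • B.toG a - k • B.toG 1) =
      B.toG (c w) + j • B.toG (u w) := by
    rw [h.ext_u ha hK.2, hj, add_smul]
    abel
  refine ⟨huB, ?_, fun q hq hqu h0 => ?_⟩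
  · rw [e]
    exact add_mem (Block.toG_mem_cone _) (nsmul_mem (Block.toG_mem_cone _) j)
  · have hqP := B.subset hq
    have h1 := congrArg (B.ext q) e
    rw [Block.ext_ext hq huB, J_eq_of_le hqP hqu, h0, map_add, map_nsmul,
      Block.ext_toG hq hcC] at h1
    have h2 := Block.eq_zero_of_toG_eq_zero hK.1 (Block.J_mem_cblock hq hcC)
      (B.eq_zero_of_add_eq_zero hK.1 (Block.toG_mem_cone _)
        (nsmul_mem (Block.ext_mem_cone hq (Block.toG_mem_cone _)) j) h1.symm)
    -- Since `J_q(c_w) = 0`, the cover `u_w` of `c_w` lies below `q'`, so `q ≤ u_w ≤ q'`.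
    exact eq_zero_of_le_ortho hqP (hqu.trans
      (((h.isCover w).2 _ (K.P.ortho_mem q hqP)).1 (le_ortho_of_J_eq_zero hqP h2)))

end IsSplitting

/-- If `m / n = k / 2 ^ N` with `k` odd, then `(n, m)` is a multiple of `(2 ^ N, k)`. -/
theorem exists_eq_mul_of_div_eq {m : ℤ} {n k N : ℕ} (hn : 0 < n) (hk : k.Coprime (2 ^ N))
    (h : (k : ℚ) / 2 ^ N = m / n) : ∃ t : ℕ, 0 < t ∧ n = t * 2 ^ N ∧ m = t * k := by
  have hn' : (n : ℚ) ≠ 0 := by positivity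
  rw [div_eq_div_iff (by positivity) hn'] at h
  have h1 : (k : ℤ) * n = m * 2 ^ N := by exact_mod_cast h
  have h2 : (2 ^ N : ℤ) ∣ n * k := ⟨m, by rw [mul_comm, h1, mul_comm]⟩
  have h3 : 2 ^ N ∣ n := hk.symm.dvd_of_dvd_mul_right (by exact_mod_cast h2)
  obtain ⟨t, rfl⟩ := h3
  refine ⟨t, Nat.pos_of_mul_pos_left hn, mul_comm _ _, ?_⟩
  have h4 : (2 ^ N : ℤ) ≠ 0 := by positivity
  apply mul_right_cancel₀ h4
  rw [← h1]
  push_cast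
  ring

namespace Block

variable {B : K.Block}

theorem spectralProjection_eq_some_of_div_eq (hK : K.BComparability) {a p : E}
    (ha : a ∈ B.cblock.carrier) {k N : ℕ} (hk : k.Coprime (2 ^ N))
    (hp : NegOn (2 ^ N • B.toG a - k • B.toG 1) p)
    (hp' : PosOn (2 ^ N • B.toG a - k • B.toG 1) (ortho p)) {m : ℤ} {n : ℕ} (hn : 0 < n)
    (h : (k : ℚ) / 2 ^ N = m / n) : B.spectralProjection ⟨a, ha⟩ m n = some p := by
  obtain ⟨t, ht, rfl, rfl⟩ := exists_eq_mul_of_div_eq hn hk h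
  refine spectralProjection_eq_some hK hp hp' ht ?_
  rw [toG_eq ha, toG_eq B.cblock.one_mem, smul_sub, mul_smul, mul_smul, natCast_zsmul,
    natCast_zsmul]
  rfl

end Block

end CompressionBase

open CompressionBase EffectAlgebra in
theorem mainTheorem1 {E : Type*} [EffectAlgebra E] (K : CompressionBase E) (hK : K.Spectral)
    (a : E) (l : ℚ) (hdyadic : ∃ (k : ℤ) (i : ℕ), l = k / 2 ^ i) (h0 : 0 ≤ l) (h1 : l ≤ 1) :
    ∃ p ∈ K.P.carrier, K.binaryResolution a l = some p ∧
      ∀ (B : K.Block) (ha : a ∈ B.cblock.carrier) (m : ℤ) (n : ℕ), 0 < n → l = m / n →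
        B.spectralProjection ⟨a, ha⟩ m n = some p := by
  obtain ⟨c, u, h⟩ := exists_isSplitting hK a
  have hcov := h.isCover_nil
  have huP := hcov.mem
  rcases dyadic_cases hdyadic h0 h1 with rfl | rfl | ⟨w, rfl⟩
  · refine ⟨_, K.P.ortho_mem _ huP, binaryResolution_zero hcov, fun B ha m n hn hmn => ?_⟩
    -- At `λ = 0` the element `g` is `a` itself: strictly positive on its cover and zero on the
    -- complement.
    have hp := h.posOn ha hK (w := []) (k := 0) (Nat.zero_le _)
    refine Block.spectralProjection_eq_some_of_div_eq hK.1 ha (k := 0) (N := 0) (by simp) ?_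
      (by rw [ortho_ortho]; exact hp) hn (by simpa using hmn)
    have hu' := B.ortho_mem hp.1
    refine ⟨hu', ?_⟩
    simp only [pow_zero, one_smul, zero_smul, sub_zero]
    rw [Block.ext_toG hu' ha, J_eq_zero (B.subset hu') (by rw [ortho_ortho]; exact hcov.le),
      Block.toG_zero, neg_zero]
    exact AddSubmonoid.zero_mem _
  · refine ⟨1, K.P.one_mem, binaryResolution_one a, fun B ha m n hn hmn => ?_⟩
    refine Block.spectralProjection_eq_some_of_div_eq hK.1 ha (k := 1) (N := 0) (by simp) ?_
      (by rw [ortho_one]; exact Block.PosOn.zero _) hn (by simpa using hmn)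
    refine ⟨B.one_mem, ?_⟩
    simp only [pow_zero, one_smul]
    rw [Block.ext_one, Block.toG_oplus ha (B.cblock.ortho_mem _ ha) (oplus_ortho a)]
    simp only [neg_sub, add_sub_cancel_left]
    exact Block.toG_mem_cone _
  · obtain ⟨t, p, hmid, hp, ht, ht'⟩ := h.exists_midProjection w
    have hmem : ∀ v ∈ binaryWords (w.length + 1), v.length = (w ++ [false]).length := by
      intro v hv
      rw [length_of_mem_binaryWords hv, List.length_append, List.length_singleton]
    have hval : wordValue (w ++ [false]) = 2 * wordValue w := by
      rw [wordValue_append, Bool.toNat_false, add_zero]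
    have htP : t ∈ K.P.carrier := osum_induction (motive := fun x => x ∈ K.P.carrier)
      K.P.zero_mem (fun x y z hz hx hy => K.P.oplus_mem _ hx _ hy _ hz) _ t ht (by
        intro x hx
        obtain ⟨v, -, rfl⟩ := List.mem_map.1 hx
        exact h.u_mem_P v)
    refine ⟨p, K.P.oplus_mem _ (K.P.ortho_mem _ huP) _ htP _ hp,
      binaryResolution_dyadicValue hmid, fun B ha m n hn hmn => ?_⟩
    rw [dyadicValue_append_true] at hmn
    refine Block.spectralProjection_eq_some_of_div_eq hK.1 ha (k := 2 * wordValue w + 1)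
      (N := w.length + 1) ?_ ?_ ?_ hn hmn
    · exact Nat.Coprime.pow_right _ (by simp)
    -- Negativity is checked on `(a°)'`, where `a` vanishes, and on each `u_v` with `v ≤ w0`.
    · refine Block.NegOn.oplus hp ?_ (osum_induction (Block.NegOn.zero _)
        (fun _ _ _ => Block.NegOn.oplus) _ t ht ?_)
      · have hu' := B.ortho_mem (h.u_mem ha hK.2 [])
        refine ⟨hu', ?_⟩
        rw [_root_.map_sub, map_nsmul, map_nsmul, Block.ext_toG hu' ha,
          J_eq_zero (B.subset hu') (by rw [ortho_ortho]; exact hcov.le),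
          Block.ext_toG hu' B.cblock.one_mem, Block.toG_zero, smul_zero, zero_sub, neg_neg]
        exact nsmul_mem (Block.toG_mem_cone _) _
      · intro x hx
        obtain ⟨v, hv, rfl⟩ := List.mem_map.1 hx
        obtain ⟨hv, hvw⟩ := List.mem_filter.1 hv
        have hvw := (word_le_iff (hmem v hv)).1 (of_decide_eq_true hvw)
        -- The word `w0` has value `2 val(w)` and `k` is one more, so `v ≤ w0` means `val(v) + 1 ≤
        -- k`; for the remaining words `k ≤ val(v)`.
        have := h.negOn ha hK.2 (w := v) (k := 2 * wordValue w + 1) (by omega)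
        rwa [length_of_mem_binaryWords hv] at this
    · refine osum_induction (Block.PosOn.zero _)
        (fun _ _ _ => Block.PosOn.oplus hK.1) _ _ ht' ?_
      intro x hx
      obtain ⟨v, hv, rfl⟩ := List.mem_map.1 hx
      obtain ⟨hv, hvw⟩ := List.mem_filter.1 hv
      have hvw : ¬ v ≤ w ++ [false] := by simpa using hvw
      rw [word_le_iff (hmem v hv)] at hvw
      have := h.posOn ha hK (w := v) (k := 2 * wordValue w + 1) (by omega)
      rwa [length_of_mem_binaryWords hv] at this
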